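/- **Setting.** Let $\mathcal X,\mathcal A$ be finite sets ($\mathcal A\neq\emptyset$), $p(x'\mid x,a)$ transition probabilities, $\mu$ an initial distribution on $\mathcal X$, $r:\mathcal X\times\mathcal A\to[0,1]$ a reward and $\gamma\in(0,1)$ a discount factor. For a policy $f$ (each $f(x,\cdot)$ a probability distribution on $\mathcal A$) put, with $a_k\sim f(x_k,\cdot)$ and $x_{k+1}\sim p(\cdot\mid x_k,a_k)$, $$V^f(x)=\mathbf E\Big[\sum_{k\ge0}\gamma^k r(x_k,a_k)\,\Big|\,x_0=x\Big],\quad V^f(x,a)=\mathbf E\Big[\sum_{k\ge0}\gamma^k r(x_k,a_k)\,\Big|\,x_0=x,a_0=a\Big],$$ $$J(f)=\sum_x\mu(x)V^f(x),\qquad \sigma^f_\mu(x,a)=\sum_{k\ge0}\gamma^k\,\mathbf P(x_k=x,a_k=a)\quad(x_0\sim\mu).$$ For $\theta\in\mathbb R^{\mathcal X\times\mathcal A}$ and $t\ge0$ let $f_\theta(x,a)=e^{\theta(x,a)}/\sum_{a'}e^{\theta(x,a')}$, $$\zeta_t=\frac1{1+t},\qquad \eta_t=\frac1{1+\log^2(t+1)},\qquad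 g_{\theta}(x,a)=g_{\theta,t}(x,a)=\frac{\eta_t}{|\mathcal A|}+(1-\eta_t)f_\theta(x,a).$$ Assume that for all $\theta$ and $t\ge 0$ the Markov chain on $\mathcal X\times\mathcal A$ with transition probabilities $p(x'\mid x,a)\,g_{\theta,t}(x',a')$ is irreducible and aperiodic, and let $\pi^{g_\theta}$ be its unique stationary distribution. Let $\alpha>0$ and $\kappa>0$ be constants, and let $(\bar Q_t,\bar\theta_t)_{t\ge0}$ be any solution on $[0,\infty)$, with arbitrary initial value, of the limit ODE $$\frac{d\bar Q_t}{dt}(x,a)=\alpha\,\pi^{g_{\bar\theta_t}}(x,a)\Big(r(x,a)+\gamma\sum_{z,a''}\bar Q_t(z,a'')g_{\bar\theta_t}(z,a'')p(z\mid x,a)-\bar Q_t(x,a)\Big),$$ $$\frac{d\bar\theta_t}{dt}(x,a)=\zeta_t\,\kappa\,\sigma_\mu^{f_{\bar\theta_t}}(x,a)\Big[\bar Q_t(x,a)-\sum_{a'}\bar Q_t(x,a')f_{\bar\theta_t}(x,a')\Big].$$ (With $\kappa=1$ the actor equation uses the visiting measure $\sigma_\mu^f$ itself; with $\kappa=1-\gamma$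 it uses its normalization to a probability distribution.) **Theorem 2 (Global Convergence).** The critic converges to the state-action value function: as $t\to\infty$, $$\big\|\bar Q_t-V^{f_{\bar\theta_t}}(\cdot,\cdot)\big\|=O\Big(\frac1{\log^2 t}\Big).$$ If moreover $\mu(x)>0$ for all $x\in\mathcal X$, then for every optimal policy $f^*$ (a maximizer of $J$ over all policies), as $t\to\infty$, $$J(f^*)-J(f_{\bar\theta_t})=O\Big(\frac1{\log t}\Big).$$ -/

import Mathlib

open Filter Topology

noncomputable section

namespace ActorCritic

/-- A finite Markov decision process: transition probabilities `p x a x' = p(x' | x, a)`, initial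
distribution `μ`, reward `r` and discount factor `γ ∈ (0, 1)`. -/
structure MDP (X A : Type*) [Fintype X] where
  p : X → A → X → ℝ
  μ : X → ℝ
  r : X → A → ℝ
  γ : ℝ
  p_nonneg : ∀ x a x', 0 ≤ p x a x'
  p_sum : ∀ x a, ∑ x', p x a x' = 1
  μ_nonneg : ∀ x, 0 ≤ μ x
  μ_sum : ∑ x, μ x = 1
  γ_pos : 0 < γ
  γ_lt_one : γ < 1

/-- `f x a` is the probability of choosing the action `a` in the state `x`. -/
def IsPolicy {X A : Type*} [Fintype A] (f : X → A → ℝ) : Prop :=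
  (∀ x a, 0 ≤ f x a) ∧ ∀ x, ∑ a, f x a = 1

/-- The tabular softmax policy `f_θ`. -/
def softmax {X A : Type*} [Fintype A] (θ : X → A → ℝ) (x : X) (a : A) : ℝ :=
  Real.exp (θ x a) / ∑ a', Real.exp (θ x a')

/-- The limiting learning rate `ζ_t`. -/
def learningRate (t : ℝ) : ℝ := 1 / (1 + t)

/-- The limiting exploration rate `η_t`. -/
def explorationRate (t : ℝ) : ℝ := 1 / (1 + Real.log (t + 1) ^ 2)

/-- The exploration policy `g_θ` at time `t`: uniform with probability `η_t`, otherwise `f_θ`. -/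
def explore {X A : Type*} [Fintype A] (t : ℝ) (θ : X → A → ℝ) (x : X) (a : A) : ℝ :=
  explorationRate t / (Fintype.card A : ℝ) + (1 - explorationRate t) * softmax θ x a

/-- The chain with transition matrix `P` is aperiodic: `1` is the only common divisor of the
return times of any state. -/
def IsAperiodic {S : Type*} [Fintype S] [DecidableEq S] (P : Matrix S S ℝ) : Prop :=
  ∀ s : S, ∀ d : ℕ, (∀ n : ℕ, 0 < n → 0 < (P ^ n) s s → d ∣ n) → d = 1

/-- `π` is a stationary probability distribution of the chain with transition matrix `P`. -/
def IsStationaryDistribution {S : Type*} [Fintype S] (P : Matrix S S ℝ) (π : S → ℝ) : Prop :=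
  (∀ s, 0 ≤ π s) ∧ ∑ s, π s = 1 ∧ Matrix.vecMul π P = π

namespace MDP

variable {X A : Type*} [Fintype X] [Fintype A] [DecidableEq X] [DecidableEq A]

/-- Transition matrix of the state-action chain under the policy `f`:
`(x, a) → (x', a')` has probability `p(x' | x, a) f(x', a')`. -/
def transition (M : MDP X A) (f : X → A → ℝ) : Matrix (X × A) (X × A) ℝ :=
  Matrix.of fun s s' => M.p s.1 s.2 s'.1 * f s'.1 s'.2

/-- Law of `(x_k, a_k)` under the policy `f` when `(x_0, a_0)` has law `ρ`. -/
def law (M : MDP X A) (f : X → A → ℝ) (ρ : X × A → ℝ) (k : ℕ) : X × A → ℝ :=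
  Matrix.vecMul ρ (M.transition f ^ k)

/-- Expected discounted sum of rewards `∑ k, γ ^ k E[r(x_k, a_k)]` under the policy `f` when
`(x_0, a_0)` has law `ρ`. -/
def discountedReward (M : MDP X A) (f : X → A → ℝ) (ρ : X × A → ℝ) : ℝ :=
  ∑' k : ℕ, M.γ ^ k * ∑ s : X × A, M.law f ρ k s * M.r s.1 s.2

/-- The state value function `V^f(x)`: start in `x_0 = x` with `a_0 ∼ f(x, ·)`. -/
def stateValue (M : MDP X A) (f : X → A → ℝ) (x : X) : ℝ :=
  M.discountedReward f fun s => if s.1 = x then f x s.2 else 0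

/-- The state-action value function `V^f(x, a)`: start in `(x_0, a_0) = (x, a)`. -/
def actionValue (M : MDP X A) (f : X → A → ℝ) (x : X) (a : A) : ℝ :=
  M.discountedReward f fun s => if s = (x, a) then 1 else 0

/-- The objective `J(f) = ∑ x, μ(x) V^f(x)`. -/
def objective (M : MDP X A) (f : X → A → ℝ) : ℝ :=
  ∑ x, M.μ x * M.stateValue f x

/-- `f` maximizes the objective over all policies. -/
def IsOptimalPolicy (M : MDP X A) (f : X → A → ℝ) : Prop :=
  IsPolicy f ∧ ∀ f' : X → A → ℝ, IsPolicy f' → M.objective f' ≤ M.objective f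

/-- The state-action visiting measure `σ_μ^f(x, a) = ∑ k, γ ^ k P(x_k = x, a_k = a)` with
`x_0 ∼ μ` and `a_0 ∼ f(x_0, ·)`. -/
def visitingMeasure (M : MDP X A) (f : X → A → ℝ) (x : X) (a : A) : ℝ :=
  ∑' k : ℕ, M.γ ^ k * M.law f (fun s => M.μ s.1 * f s.1 s.2) k (x, a)

/-- For all parameters `θ` and times `t ≥ 0`, the state-action chain under the exploration policy
is irreducible and aperiodic. -/
def IsErgodic (M : MDP X A) : Prop :=
  ∀ t : ℝ, 0 ≤ t → ∀ θ : X → A → ℝ,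
    (M.transition (explore t θ)).IsIrreducible ∧ IsAperiodic (M.transition (explore t θ))

/-- `(Q, θ)` solves the limit system on `[0, ∞)`, with critic learning rate `α`. Here `π t` is
the stationary distribution of the chain under the exploration policy `g_{θ_t}` (it is unique when
that chain is irreducible), and the visiting measure is normalized by the constant `κ`: `κ = 1`
gives the visiting measure itself, `κ = 1 - γ` the corresponding probability distribution. -/
def IsLimitSolution (M : MDP X A) (α κ : ℝ) (Q θ : ℝ → X → A → ℝ) : Prop :=
  ∃ π : ℝ → X × A → ℝ, ∀ t : ℝ, 0 ≤ t →
    IsStationaryDistribution (M.transition (explore t (θ t))) (π t) ∧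
    ∀ x a,
      HasDerivWithinAt (fun s => Q s x a)
        (α * π t (x, a) * (M.r x a
          + M.γ * (∑ z, ∑ a'', Q t z a'' * explore t (θ t) z a'' * M.p x a z) - Q t x a))
        (Set.Ici 0) t ∧
      HasDerivWithinAt (fun s => θ s x a)
        (learningRate t * (κ * M.visitingMeasure (softmax (θ t)) x a) *
          (Q t x a - ∑ a', Q t x a' * softmax (θ t) x a'))
        (Set.Ici 0) t

end MDP

end ActorCritic

end

/-!
In the rescaled time `log (1 + t)` the actor follows a softmax policy gradient flow whose action
values are supplied by the critic, and everything rests on the critic being much faster.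

*The critic.* The chains of the exploration policies dominate `η_t` times the chain of the uniform
policy, so their stationary probabilities are at least `c η_t ^ N`
(`MDP.IsErgodic.exists_le_stationary`). Hence the critic contracts in the sup norm, towards the
action values of the exploration policy, at a rate that decays only polylogarithmically. The action
values of the current policy move at speed `O(1 / (1 + t))`, which is negligible against that rate,
and they differ from those of the exploration policy by `O(η_t)`. So `K η_t` is a barrier for the
error of the critic (`MDP.IsLimitSolution.exists_abs_critic_sub_le`).

*Monotonicity.* By the performance difference identity, every state value increases along the actor
at a rate at least `c ∑ a, (f(x, a) A(x, a)) ^ 2`, with `A` the advantage, up to the square of the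
error of the critic (`MDP.le_valueSlope`). This error is integrable in the rescaled time, so the
state values converge.

*Optimality of the limit.* In each state the inverse weights `exp (-θ(x, a))` move by the negative
advantages at a speed common to all actions. If an action kept a positive advantage, its inverse
weight would decrease at a definite fraction of the largest possible speed. This bounds all the
inverse weights of the state and, because `∑ a, θ(x, a)` is conserved, the parameters themselves;
then the speed is bounded below and the inverse weight would become negative
(`MDP.IsLimitSolution.bellman_le_limit`). So the limit satisfies the Bellman optimality inequality
and dominates the values of every policy.

*Rate.* Close to the limit the suboptimal actions are unlikely, so in a state where the gap to the
limit is largest the most likely action is optimal, and its advantage is at least `1 - γ` times the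
gap (`MDP.exists_gap_sq_le`). Therefore the total gap `W` satisfies `W' ≤ -c W ^ 2 + C / τ ^ 2` in
the rescaled time `τ`, which gives `W ≤ K / τ`.
-/

set_option linter.unusedSectionVars false

noncomputable section

namespace ActorCritic

namespace MDP
variable {X A : Type*} [Fintype X] [Fintype A] [DecidableEq X] [DecidableEq A]

/-! ### Value functions and the Bellman equation -/

lemma one_sub_discount_pos (M : MDP X A) : 0 < 1 - M.γ := sub_pos.2 M.γ_lt_one

lemma transition_mem_rowStochastic (M : MDP X A) {f : X → A → ℝ} (hf : IsPolicy f) :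
    M.transition f ∈ Matrix.rowStochastic ℝ (X × A) := by
  rw [Matrix.mem_rowStochastic_iff_sum]
  refine ⟨fun s s' => mul_nonneg (M.p_nonneg _ _ _) (hf.1 _ _), fun s => ?_⟩
  simp [transition, Fintype.sum_prod_type, ← Finset.mul_sum, hf.2, M.p_sum]

lemma law_nonneg (M : MDP X A) {f : X → A → ℝ} (hf : IsPolicy f) {ρ : X × A → ℝ}
    (hρ : ∀ s, 0 ≤ ρ s) (k : ℕ) (s : X × A) : 0 ≤ M.law f ρ k s :=
  Finset.sum_nonneg fun i _ => mul_nonneg (hρ i)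
    ((Matrix.mem_rowStochastic.1 (pow_mem (M.transition_mem_rowStochastic hf) k)).1 i s)

lemma sum_law (M : MDP X A) {f : X → A → ℝ} (hf : IsPolicy f) (ρ : X × A → ℝ) (k : ℕ) :
    ∑ s, M.law f ρ k s = ∑ s, ρ s := by
  have h := Matrix.sum_row_of_mem_rowStochastic (pow_mem (M.transition_mem_rowStochastic hf) k)
  simp only [law, Matrix.vecMul, dotProduct]
  rw [Finset.sum_comm]
  simp [← Finset.mul_sum, h]

lemma law_succ (M : MDP X A) (f : X → A → ℝ) (ρ : X × A → ℝ) (k : ℕ) (x : X) (a : A) :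
    M.law f ρ (k + 1) (x, a) = f x a * ∑ s, M.law f ρ k s * M.p s.1 s.2 x := by
  rw [law, pow_succ, ← Matrix.vecMul_vecMul, Finset.mul_sum]
  exact Finset.sum_congr rfl fun s _ => by simp [law, transition]; ring

lemma law_succ' (M : MDP X A) (f : X → A → ℝ) (ρ : X × A → ℝ) (k : ℕ) :
    M.law f ρ (k + 1) = M.law f (Matrix.vecMul ρ (M.transition f)) k := by
  rw [law, pow_succ', ← Matrix.vecMul_vecMul, law]

lemma summable_discounted (M : MDP X A) {u : ℕ → ℝ} {C : ℝ} (hu : ∀ k, |u k| ≤ C) :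
    Summable fun k => M.γ ^ k * u k := by
  refine Summable.of_norm_bounded
    ((summable_geometric_of_lt_one M.γ_pos.le M.γ_lt_one).mul_right C) fun k => ?_
  rw [norm_mul, norm_pow, Real.norm_of_nonneg M.γ_pos.le]
  exact mul_le_mul_of_nonneg_left (hu k) (pow_nonneg M.γ_pos.le k)

lemma abs_pow_transition_mulVec_le (M : MDP X A) {f : X → A → ℝ} (hf : IsPolicy f)
    (k : ℕ) (s : X × A) :
    |∑ s', (M.transition f ^ k) s s' * M.r s'.1 s'.2| ≤ ∑ s' : X × A, |M.r s'.1 s'.2| := by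
  refine (Finset.abs_sum_le_sum_abs _ _).trans (Finset.sum_le_sum fun s' _ => ?_)
  have h := pow_mem (M.transition_mem_rowStochastic hf) k
  rw [abs_mul, abs_of_nonneg (Matrix.nonneg_of_mem_rowStochastic h)]
  exact mul_le_of_le_one_left (abs_nonneg _) (Matrix.le_one_of_mem_rowStochastic h)

lemma actionValue_eq (M : MDP X A) (f : X → A → ℝ) (s : X × A) :
    M.actionValue f s.1 s.2
      = ∑' k : ℕ, M.γ ^ k * ∑ s', (M.transition f ^ k) s s' * M.r s'.1 s'.2 := by
  simp [actionValue, discountedReward, law, Matrix.vecMul, dotProduct]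

/-- The discounted reward is linear in the law of the initial pair. -/
lemma discountedReward_eq_sum (M : MDP X A) {f : X → A → ℝ} (hf : IsPolicy f) (ρ : X × A → ℝ) :
    M.discountedReward f ρ = ∑ s, ρ s * M.actionValue f s.1 s.2 := by
  have hs : ∀ s, Summable fun k : ℕ =>
      ρ s * (M.γ ^ k * ∑ s', (M.transition f ^ k) s s' * M.r s'.1 s'.2) := fun s =>
    (M.summable_discounted fun k => M.abs_pow_transition_mulVec_le hf k s).mul_left _
  simp only [actionValue_eq, ← tsum_mul_left]
  rw [← Summable.tsum_finsetSum fun s _ => hs s, discountedReward]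
  refine tsum_congr fun k => ?_
  simp only [law, Matrix.vecMul, dotProduct, Finset.mul_sum, Finset.sum_mul]
  rw [Finset.sum_comm]
  exact Finset.sum_congr rfl fun s _ => Finset.sum_congr rfl fun s' _ => by ring

lemma stateValue_eq (M : MDP X A) {f : X → A → ℝ} (hf : IsPolicy f) (x : X) :
    M.stateValue f x = ∑ a, f x a * M.actionValue f x a := by
  rw [stateValue, discountedReward_eq_sum M hf, Fintype.sum_prod_type]
  simp [ite_mul]

lemma actionValue_bellman (M : MDP X A) {f : X → A → ℝ} (hf : IsPolicy f) (x : X) (a : A) :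
    M.actionValue f x a = M.r x a + M.γ * ∑ z, M.p x a z * M.stateValue f z := by
  have h1 : M.actionValue f x a = M.r x a + M.γ * M.discountedReward f
      (Matrix.vecMul (fun s => if s = (x, a) then 1 else 0) (M.transition f)) := by
    have hs : Summable fun k : ℕ => M.γ ^ k * ∑ s' : X × A,
        M.law f (fun s => if s = (x, a) then 1 else 0) k s' * M.r s'.1 s'.2 :=
      M.summable_discounted (C := ∑ s' : X × A, |M.r s'.1 s'.2|) fun k => by
        simpa [law, Matrix.vecMul, dotProduct] using M.abs_pow_transition_mulVec_le hf k (x, a)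
    rw [actionValue, discountedReward, hs.tsum_eq_zero_add, discountedReward, ← tsum_mul_left]
    congr 1
    · simp [law]
    · exact tsum_congr fun k => by rw [law_succ', pow_succ']; ring
  rw [h1, discountedReward_eq_sum M hf, Fintype.sum_prod_type]
  simp only [stateValue_eq M hf, Finset.mul_sum]
  simp [Matrix.vecMul, dotProduct, transition, mul_assoc]

/-- Discounted occupancy `∑ k, γ ^ k P(x_k = x)` of the state `x` under the policy `f`, for
`x_0 ∼ μ`. -/
def stateOccupancy (M : MDP X A) (f : X → A → ℝ) (x : X) : ℝ :=
  ∑' k : ℕ, M.γ ^ k * ∑ a, M.law f (fun s => M.μ s.1 * f s.1 s.2) k (x, a)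

lemma sum_initial (M : MDP X A) {f : X → A → ℝ} (hf : IsPolicy f) :
    ∑ s : X × A, M.μ s.1 * f s.1 s.2 = 1 := by
  simp [Fintype.sum_prod_type, ← Finset.mul_sum, hf.2, M.μ_sum]

lemma marginal_mem_Icc (M : MDP X A) {f : X → A → ℝ} (hf : IsPolicy f) (k : ℕ) (x : X) :
    ∑ a, M.law f (fun s => M.μ s.1 * f s.1 s.2) k (x, a) ∈ Set.Icc (0 : ℝ) 1 := by
  have h0 := M.law_nonneg hf (fun s => mul_nonneg (M.μ_nonneg s.1) (hf.1 s.1 s.2)) k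
  refine ⟨Finset.sum_nonneg fun a _ => h0 _, ?_⟩
  rw [← M.sum_initial hf, ← M.sum_law hf _ k, Fintype.sum_prod_type]
  exact Finset.single_le_sum
    (f := fun x => ∑ a, M.law f (fun s => M.μ s.1 * f s.1 s.2) k (x, a))
    (fun y _ => Finset.sum_nonneg fun a _ => h0 (y, a)) (Finset.mem_univ x)

lemma visitingMeasure_eq (M : MDP X A) {f : X → A → ℝ} (hf : IsPolicy f) (x : X) (a : A) :
    M.visitingMeasure f x a = f x a * M.stateOccupancy f x := by
  rw [visitingMeasure, stateOccupancy, ← tsum_mul_left]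
  refine tsum_congr fun k => ?_
  suffices h : M.law f (fun s => M.μ s.1 * f s.1 s.2) k (x, a)
      = f x a * ∑ b, M.law f (fun s => M.μ s.1 * f s.1 s.2) k (x, b) by
    rw [h]; ring
  cases k with
  | zero => simp [law, ← Finset.mul_sum, hf.2, mul_comm (f x a)]
  | succ k => simp [law_succ, ← Finset.sum_mul, hf.2]

lemma summable_occupancy (M : MDP X A) {f : X → A → ℝ} (hf : IsPolicy f) (x : X) :
    Summable fun k : ℕ => M.γ ^ k * ∑ a, M.law f (fun s => M.μ s.1 * f s.1 s.2) k (x, a) :=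
  M.summable_discounted (C := 1) fun k => by
    rw [abs_of_nonneg (M.marginal_mem_Icc hf k x).1]; exact (M.marginal_mem_Icc hf k x).2

lemma le_stateOccupancy (M : MDP X A) {f : X → A → ℝ} (hf : IsPolicy f) (x : X) :
    M.μ x ≤ M.stateOccupancy f x := by
  have h := (M.summable_occupancy hf x).le_tsum 0
    fun k _ => mul_nonneg (pow_nonneg M.γ_pos.le k) (M.marginal_mem_Icc hf k x).1
  rw [stateOccupancy]
  refine le_trans (le_of_eq ?_) h
  simp [law, ← Finset.mul_sum, hf.2]

lemma stateOccupancy_nonneg (M : MDP X A) {f : X → A → ℝ} (hf : IsPolicy f) (x : X) :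
    0 ≤ M.stateOccupancy f x :=
  (M.μ_nonneg x).trans (M.le_stateOccupancy hf x)

lemma stateOccupancy_le (M : MDP X A) {f : X → A → ℝ} (hf : IsPolicy f) (x : X) :
    M.stateOccupancy f x ≤ (1 - M.γ)⁻¹ := by
  rw [← tsum_geometric_of_lt_one M.γ_pos.le M.γ_lt_one]
  exact (M.summable_occupancy hf x).tsum_le_tsum
    (fun k => mul_le_of_le_one_right (pow_nonneg M.γ_pos.le k) (M.marginal_mem_Icc hf k x).2)
    (summable_geometric_of_lt_one M.γ_pos.le M.γ_lt_one)

/-! ### The resolvent of the state chain -/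

/-- Transition matrix of the state chain under the policy `f`. -/
def stateKernel (M : MDP X A) (f : X → A → ℝ) : Matrix X X ℝ :=
  Matrix.of fun x z => ∑ a, f x a * M.p x a z

lemma stateKernel_mulVec (M : MDP X A) (f : X → A → ℝ) (v : X → ℝ) (x : X) :
    ∑ z, M.stateKernel f x z * v z = ∑ a, f x a * ∑ z, M.p x a z * v z := by
  simp only [stateKernel, Matrix.of_apply, Finset.sum_mul, Finset.mul_sum, mul_assoc]
  exact Finset.sum_comm

lemma stateKernel_nonneg (M : MDP X A) {f : X → A → ℝ} (hf : IsPolicy f) (x z : X) :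
    0 ≤ M.stateKernel f x z :=
  Finset.sum_nonneg fun a _ => mul_nonneg (hf.1 x a) (M.p_nonneg x a z)

lemma sum_stateKernel (M : MDP X A) {f : X → A → ℝ} (hf : IsPolicy f) (x : X) :
    ∑ z, M.stateKernel f x z = 1 := by
  simpa [M.p_sum, hf.2] using M.stateKernel_mulVec f 1 x

/-- Maximum principle: a function dominating its discounted average is nonnegative. -/
lemma nonneg_of_discounted_le (M : MDP X A) {f : X → A → ℝ} (hf : IsPolicy f) {v : X → ℝ}
    (hv : ∀ x, M.γ * ∑ z, M.stateKernel f x z * v z ≤ v x) (x : X) : 0 ≤ v x := by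
  have : Nonempty X := ⟨x⟩
  obtain ⟨x₀, h₀⟩ := Finite.exists_min v
  have h1 : v x₀ ≤ ∑ z, M.stateKernel f x₀ z * v z := by
    calc v x₀ = ∑ z, M.stateKernel f x₀ z * v x₀ := by
          rw [← Finset.sum_mul, M.sum_stateKernel hf, one_mul]
      _ ≤ _ := Finset.sum_le_sum fun z _ =>
          mul_le_mul_of_nonneg_left (h₀ z) (M.stateKernel_nonneg hf x₀ z)
  have h2 := mul_le_mul_of_nonneg_left h1 M.γ_pos.le
  have h3 := hv x₀
  have h4 := M.one_sub_discount_pos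
  have h5 : 0 ≤ v x₀ := by
    by_contra! h
    nlinarith
  exact h5.trans (h₀ x)

lemma det_one_sub_stateKernel_ne_zero (M : MDP X A) {f : X → A → ℝ} (hf : IsPolicy f) :
    (1 - M.γ • M.stateKernel f).det ≠ 0 := by
  intro h
  obtain ⟨v, hv0, hv⟩ := Matrix.exists_mulVec_eq_zero_iff.2 h
  have hv' : ∀ x, v x = M.γ * ∑ z, M.stateKernel f x z * v z := fun x => by
    have := congrFun hv x
    simp only [Matrix.sub_mulVec, Matrix.one_mulVec, Matrix.smul_mulVec, Pi.sub_apply,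
      Pi.smul_apply, smul_eq_mul, Pi.zero_apply, sub_eq_zero] at this
    exact this
  refine hv0 (funext fun x => le_antisymm ?_ (M.nonneg_of_discounted_le hf (fun x => (hv' x).ge) x))
  have := M.nonneg_of_discounted_le hf (v := -v) (fun x => by
    simp only [Pi.neg_apply, mul_neg, Finset.sum_neg_distrib]
    exact (neg_inj.2 (hv' x)).ge) x
  simpa using this

/-- The resolvent `(1 - γ P_f)⁻¹ = ∑ k, γ ^ k P_f ^ k` of the state chain. -/
def resolvent (M : MDP X A) (f : X → A → ℝ) : Matrix X X ℝ :=
  (1 - M.γ • M.stateKernel f)⁻¹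

lemma resolvent_eq (M : MDP X A) {f : X → A → ℝ} (hf : IsPolicy f) (x y : X) :
    M.resolvent f x y = (if x = y then 1 else 0)
      + M.γ * ∑ z, M.stateKernel f x z * M.resolvent f z y := by
  have h := Matrix.mul_nonsing_inv _ (M.det_one_sub_stateKernel_ne_zero hf).isUnit
  have h' := congrFun (congrFun h x) y
  rw [Matrix.sub_mul, Matrix.one_mul, Matrix.smul_mul, Matrix.sub_apply, Matrix.smul_apply,
    smul_eq_mul, Matrix.mul_apply, Matrix.one_apply] at h'
  rw [resolvent]; linarith

lemma resolvent_nonneg (M : MDP X A) {f : X → A → ℝ} (hf : IsPolicy f) (x y : X) :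
    0 ≤ M.resolvent f x y :=
  M.nonneg_of_discounted_le hf (v := fun z => M.resolvent f z y) (fun z => by
    rw [M.resolvent_eq hf z y]
    split_ifs <;> linarith) x

lemma one_le_resolvent_self (M : MDP X A) {f : X → A → ℝ} (hf : IsPolicy f) (x : X) :
    1 ≤ M.resolvent f x x := by
  rw [M.resolvent_eq hf x x, if_pos rfl]
  exact le_add_of_nonneg_right (mul_nonneg M.γ_pos.le (Finset.sum_nonneg fun z _ =>
    mul_nonneg (M.stateKernel_nonneg hf x z) (M.resolvent_nonneg hf z x)))

lemma resolvent_mulVec (M : MDP X A) {f : X → A → ℝ} (hf : IsPolicy f) {v h : X → ℝ}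
    (hv : ∀ x, v x = h x + M.γ * ∑ z, M.stateKernel f x z * v z) (x : X) :
    v x = ∑ z, M.resolvent f x z * h z := by
  have h1 : (1 - M.γ • M.stateKernel f).mulVec v = h := by
    funext y
    simp only [Matrix.sub_mulVec, Matrix.one_mulVec, Matrix.smul_mulVec, Pi.sub_apply,
      Pi.smul_apply, smul_eq_mul]
    exact sub_eq_of_eq_add (hv y)
  have h2 : v = (M.resolvent f).mulVec h := by
    rw [← h1, resolvent, Matrix.mulVec_mulVec,
      Matrix.nonsing_inv_mul _ (M.det_one_sub_stateKernel_ne_zero hf).isUnit, Matrix.one_mulVec]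
  exact congrFun h2 x

lemma sum_resolvent (M : MDP X A) {f : X → A → ℝ} (hf : IsPolicy f) (x : X) :
    ∑ z, M.resolvent f x z = (1 - M.γ)⁻¹ := by
  have h4 := M.one_sub_discount_pos
  have := M.resolvent_mulVec hf (v := fun _ => (1 - M.γ)⁻¹) (h := fun _ => 1) (fun x => by
    rw [← Finset.sum_mul, M.sum_stateKernel hf]; field_simp; ring) x
  simpa using this.symm

lemma continuousAt_resolvent (M : MDP X A) {f : X → A → ℝ} (hf : IsPolicy f) (x z : X) :
    ContinuousAt (fun g => M.resolvent g x z) f := by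
  have h1 : Continuous fun g : X → A → ℝ => 1 - M.γ • M.stateKernel g := by
    have h0 : Continuous fun g : X → A → ℝ => M.stateKernel g := continuous_matrix fun x z => by
      simp only [stateKernel, Matrix.of_apply]
      fun_prop
    have h0' : Continuous fun g : X → A → ℝ => M.γ • M.stateKernel g := h0.const_smul M.γ
    exact continuous_const.sub h0'
  have h2 : ContinuousAt Inv.inv (1 - M.γ • M.stateKernel f) := by
    refine continuousAt_matrix_inv _ ?_
    rw [Ring.inverse_eq_inv']
    exact continuousAt_inv₀ (M.det_one_sub_stateKernel_ne_zero hf)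
  have h3 := ContinuousAt.comp (f := fun g : X → A → ℝ => 1 - M.γ • M.stateKernel g)
    (x := f) h2 h1.continuousAt
  exact ((continuous_apply_apply x z).continuousAt (x := M.resolvent f)).comp h3

lemma stateValue_bellman (M : MDP X A) {f : X → A → ℝ} (hf : IsPolicy f) (x : X) :
    M.stateValue f x = ∑ a, f x a * M.r x a
      + M.γ * ∑ z, M.stateKernel f x z * M.stateValue f z := by
  rw [M.stateKernel_mulVec, M.stateValue_eq hf, Finset.mul_sum, ← Finset.sum_add_distrib]
  exact Finset.sum_congr rfl fun a _ => by rw [M.actionValue_bellman hf]; ring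

/-- Performance difference: the gain from replacing the policy `f` by `g` is the resolvent of `g`
applied to the one-step gain of `g` measured by the action values of `f`. -/
lemma stateValue_sub (M : MDP X A) {f g : X → A → ℝ} (hf : IsPolicy f) (hg : IsPolicy g) (x : X) :
    M.stateValue g x - M.stateValue f x
      = ∑ z, M.resolvent g x z * ∑ a, (g z a - f z a) * M.actionValue f z a := by
  refine M.resolvent_mulVec hg (v := fun x => M.stateValue g x - M.stateValue f x) (fun y => ?_) x
  have h1 : ∑ a, (g y a - f y a) * M.actionValue f y a
      = ∑ a, g y a * M.r y a + M.γ * ∑ z, M.stateKernel g y z * M.stateValue f z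
        - M.stateValue f y := by
    rw [M.stateValue_eq hf y, M.stateKernel_mulVec, Finset.mul_sum, ← Finset.sum_add_distrib,
      ← Finset.sum_sub_distrib]
    exact Finset.sum_congr rfl fun a _ => by rw [M.actionValue_bellman hf]; ring
  rw [h1, M.stateValue_bellman hg y]
  simp only [mul_sub, Finset.sum_sub_distrib]
  ring

lemma stateValue_mem_Icc (M : MDP X A) (hr : ∀ x a, 0 ≤ M.r x a ∧ M.r x a ≤ 1) {f : X → A → ℝ}
    (hf : IsPolicy f) (x : X) : M.stateValue f x ∈ Set.Icc 0 (1 - M.γ)⁻¹ := by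
  have h := M.resolvent_mulVec hf (M.stateValue_bellman hf) x
  rw [h, ← M.sum_resolvent hf x]
  refine ⟨Finset.sum_nonneg fun z _ => mul_nonneg (M.resolvent_nonneg hf x z)
    (Finset.sum_nonneg fun a _ => mul_nonneg (hf.1 z a) (hr z a).1),
    Finset.sum_le_sum fun z _ => mul_le_of_le_one_right (M.resolvent_nonneg hf x z) ?_⟩
  rw [← hf.2 z]
  exact Finset.sum_le_sum fun a _ => mul_le_of_le_one_right (hf.1 z a) (hr z a).2

lemma actionValue_mem_Icc (M : MDP X A) (hr : ∀ x a, 0 ≤ M.r x a ∧ M.r x a ≤ 1) {f : X → A → ℝ}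
    (hf : IsPolicy f) (x : X) (a : A) : M.actionValue f x a ∈ Set.Icc 0 (1 - M.γ)⁻¹ := by
  have h4 := M.one_sub_discount_pos
  have h1 : ∑ z, M.p x a z * M.stateValue f z ≤ (1 - M.γ)⁻¹ := by
    calc _ ≤ ∑ z, M.p x a z * (1 - M.γ)⁻¹ := Finset.sum_le_sum fun z _ =>
          mul_le_mul_of_nonneg_left (M.stateValue_mem_Icc hr hf z).2 (M.p_nonneg x a z)
      _ = _ := by rw [← Finset.sum_mul, M.p_sum, one_mul]
  rw [M.actionValue_bellman hf]
  refine ⟨add_nonneg (hr x a).1 (mul_nonneg M.γ_pos.le (Finset.sum_nonneg fun z _ =>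
    mul_nonneg (M.p_nonneg x a z) (M.stateValue_mem_Icc hr hf z).1)), ?_⟩
  calc _ ≤ 1 + M.γ * (1 - M.γ)⁻¹ :=
        add_le_add (hr x a).2 (mul_le_mul_of_nonneg_left h1 M.γ_pos.le)
    _ = _ := by field_simp; ring

/-- Policy gradient theorem along a differentiable curve of policies. -/
lemma hasDerivWithinAt_stateValue (M : MDP X A) {F : ℝ → X → A → ℝ} {F' : X → A → ℝ} {s : Set ℝ}
    {t : ℝ} (hF : ∀ u, IsPolicy (F u))
    (hF' : ∀ x a, HasDerivWithinAt (fun u => F u x a) (F' x a) s t) (x : X) :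
    HasDerivWithinAt (fun u => M.stateValue (F u) x)
      (∑ z, M.resolvent (F t) x z * ∑ a, F' z a * M.actionValue (F t) z a) s t := by
  have hcont : ContinuousWithinAt F s t :=
    continuousWithinAt_pi.2 fun x => continuousWithinAt_pi.2 fun a => (hF' x a).continuousWithinAt
  rw [hasDerivWithinAt_iff_tendsto_slope]
  have hslope : slope (fun u => M.stateValue (F u) x) t = fun u => ∑ z, M.resolvent (F u) x z *
      ∑ a, slope (fun u => F u z a) t u * M.actionValue (F t) z a := by
    funext u
    simp only [slope_def_field, M.stateValue_sub (hF t) (hF u), Finset.sum_div, mul_div_assoc,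
      div_mul_eq_mul_div]
  rw [hslope]
  refine tendsto_finsetSum _ fun z _ => Tendsto.mul ?_ (tendsto_finsetSum _ fun a _ =>
    Tendsto.mul_const _ (hasDerivWithinAt_iff_tendsto_slope.1 (hF' z a)))
  exact (M.continuousAt_resolvent (hF t) x z).tendsto.comp
    (hcont.tendsto.mono_left (nhdsWithin_mono t Set.sdiff_subset))

end MDP

/-! ### Differential inequalities on a half-line -/

lemma monotoneOn_Ici_of_hasDerivWithinAt {f f' : ℝ → ℝ} {T : ℝ} (hT : 0 ≤ T)
    (hf : ∀ t, T ≤ t → HasDerivWithinAt f (f' t) (Set.Ici 0) t) (hf' : ∀ t, T ≤ t → 0 ≤ f' t) :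
    MonotoneOn f (Set.Ici T) := by
  have hsub : Set.Ici T ⊆ Set.Ici (0 : ℝ) := Set.Ici_subset_Ici.2 hT
  refine monotoneOn_of_hasDerivWithinAt_nonneg (f' := f') (convex_Ici T)
    (fun t ht => ((hf t ht).mono hsub).continuousWithinAt) (fun t ht => ?_) (fun t ht => ?_)
  · exact (hf t (interior_subset ht)).mono (interior_subset.trans hsub)
  · exact hf' t (interior_subset ht)

lemma antitoneOn_Ici_of_hasDerivWithinAt {f f' : ℝ → ℝ} {T : ℝ} (hT : 0 ≤ T)
    (hf : ∀ t, T ≤ t → HasDerivWithinAt f (f' t) (Set.Ici 0) t) (hf' : ∀ t, T ≤ t → f' t ≤ 0) :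
    AntitoneOn f (Set.Ici T) := by
  have h := monotoneOn_Ici_of_hasDerivWithinAt (f := -f) (f' := -f') hT
    (fun t ht => (hf t ht).neg) (fun t ht => neg_nonneg.2 (hf' t ht))
  simpa using h.neg

/-- Finitely many functions that start nonpositive stay nonpositive if, as long as all of them are,
each one that touches `0` is decreasing there. -/
lemma forall_nonpos_of_deriv_neg {ι : Type*} [Finite ι] {g g' : ι → ℝ → ℝ} {T : ℝ}
    (hg : ∀ i t, T ≤ t → HasDerivWithinAt (g i) (g' i t) (Set.Ici T) t) (h0 : ∀ i, g i T ≤ 0)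
    (hneg : ∀ t, T ≤ t → (∀ j, g j t ≤ 0) → ∀ i, g i t = 0 → g' i t < 0) {t : ℝ} (ht : T ≤ t)
    (i : ι) : g i t ≤ 0 := by
  have hcont : ∀ i, ContinuousOn (g i) (Set.Icc T t) := fun i u hu =>
    ((hg i u hu.1).mono Set.Icc_subset_Ici_self).continuousWithinAt
  suffices h : Set.Icc T t ⊆ {u | ∀ i, g i u ≤ 0} from h ⟨ht, le_rfl⟩ i
  refine IsClosed.Icc_subset_of_forall_exists_gt ?_ h0 ?_
  · have : {u | ∀ i, g i u ≤ 0} ∩ Set.Icc T t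
        = Set.Icc T t ∩ ⋂ i, {u ∈ Set.Icc T t | g i u ≤ 0} := by
      ext u
      simp only [Set.mem_inter_iff, Set.mem_ofPred_eq, Set.mem_iInter]
      exact ⟨fun h => ⟨h.2, fun i => ⟨h.2, h.1 i⟩⟩, fun h => ⟨fun i => (h.2 i).2, h.1⟩⟩
    rw [this]
    exact isClosed_Icc.inter (isClosed_iInter fun i =>
      isClosed_Icc.isClosed_le (hcont i) continuousOn_const)
  · rintro u ⟨hu, huT, hut⟩ y hy
    have hev : ∀ᶠ w in 𝓝[>] u, ∀ i, g i w ≤ 0 := by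
      rw [eventually_all]
      intro i
      have hd : HasDerivWithinAt (g i) (g' i u) (Set.Ioi u) u :=
        (hg i u huT).mono fun w hw => huT.trans (le_of_lt hw)
      rcases (hu i).lt_or_eq with hlt | heq
      · exact ((hd.continuousWithinAt.tendsto).eventually_lt_const hlt).mono fun w hw => hw.le
      · have hs := (hasDerivWithinAt_iff_tendsto_slope' (Set.self_notMem_Ioi)).1 hd
        filter_upwards [hs.eventually_lt_const (hneg u huT hu i heq), self_mem_nhdsWithin]
          with w hw hwu
        rw [slope_def_field, heq, sub_zero, div_neg_iff] at hw
        have : 0 < w - u := sub_pos.2 hwu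
        rcases hw with hw | hw <;> linarith
    obtain ⟨w, hw, hwy⟩ := (hev.and (Ioc_mem_nhdsGT hy)).exists
    exact ⟨w, hw, hwy⟩

/-- A barrier for a finite system `e' = m (w - e) + ρ` that relaxes towards `w` at rate `m`. -/
lemma abs_le_of_relaxation {ι : Type*} [Finite ι] {e m w ρ : ι → ℝ → ℝ} {B B' : ℝ → ℝ} {T : ℝ}
    (hT : 0 ≤ T)
    (he : ∀ i t, T ≤ t →
      HasDerivWithinAt (e i) (m i t * (w i t - e i t) + ρ i t) (Set.Ici 0) t)
    (hB : ∀ t, T ≤ t → HasDerivWithinAt B (B' t) (Set.Ici 0) t)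
    (hm : ∀ i t, T ≤ t → 0 ≤ m i t) (h0 : ∀ i, |e i T| ≤ B T)
    (hlt : ∀ t, T ≤ t → (∀ j, |e j t| ≤ B t) → ∀ i,
      m i t * (|w i t| - B t) + |ρ i t| < B' t) {t : ℝ} (ht : T ≤ t) (i : ι) :
    |e i t| ≤ B t := by
  have hsub : Set.Ici T ⊆ Set.Ici (0 : ℝ) := Set.Ici_subset_Ici.2 hT
  have key := forall_nonpos_of_deriv_neg (ι := ι ⊕ ι) (T := T)
    (g := Sum.elim (fun i t => e i t - B t) (fun i t => -e i t - B t))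
    (g' := Sum.elim (fun i t => (m i t * (w i t - e i t) + ρ i t) - B' t)
      (fun i t => -(m i t * (w i t - e i t) + ρ i t) - B' t)) ?_ ?_ ?_ ht
  · have h1 := key (Sum.inl i)
    have h2 := key (Sum.inr i)
    simp only [Sum.elim_inl, Sum.elim_inr] at h1 h2
    exact abs_le.2 ⟨by linarith, by linarith⟩
  · rintro (i | i) t ht
    · exact ((he i t ht).sub (hB t ht)).mono hsub
    · exact ((he i t ht).neg.sub (hB t ht)).mono hsub
  · rintro (i | i)
    · have := (abs_le.1 (h0 i)).2
      simp only [Sum.elim_inl]; linarith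
    · have := (abs_le.1 (h0 i)).1
      simp only [Sum.elim_inr]; linarith
  · intro t ht hall i
    have hall' : ∀ j, |e j t| ≤ B t := fun j => by
      have h1 := hall (Sum.inl j)
      have h2 := hall (Sum.inr j)
      simp only [Sum.elim_inl, Sum.elim_inr] at h1 h2
      exact abs_le.2 ⟨by linarith, by linarith⟩
    rcases i with i | i
    · simp only [Sum.elim_inl]
      intro hi
      have h1 := hlt t ht hall' i
      have h2 : m i t * (w i t - e i t) ≤ m i t * (|w i t| - B t) :=
        mul_le_mul_of_nonneg_left (by linarith [le_abs_self (w i t)]) (hm i t ht)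
      linarith [le_abs_self (ρ i t)]
    · simp only [Sum.elim_inr]
      intro hi
      have h1 := hlt t ht hall' i
      have h2 : m i t * (e i t - w i t) ≤ m i t * (|w i t| - B t) :=
        mul_le_mul_of_nonneg_left (by linarith [neg_le_abs (w i t)]) (hm i t ht)
      linarith [neg_le_abs (ρ i t)]

/-! ### Learning and exploration rates -/

lemma learningRate_pos {t : ℝ} (ht : 0 ≤ t) : 0 < learningRate t := by
  unfold learningRate; positivity

lemma hasDerivAt_log_add_one {t : ℝ} (ht : 0 ≤ t) :
    HasDerivAt (fun s : ℝ => Real.log (s + 1)) (learningRate t) t := by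
  have h := ((hasDerivAt_id t).add_const 1).log (by simp only [id]; positivity)
  simpa [learningRate, add_comm] using h

lemma explorationRate_pos (t : ℝ) : 0 < explorationRate t := by
  unfold explorationRate; positivity

lemma explorationRate_le_one (t : ℝ) : explorationRate t ≤ 1 := by
  unfold explorationRate
  exact div_le_one_of_le₀ (by linarith [sq_nonneg (Real.log (t + 1))]) (by positivity)

lemma hasDerivAt_explorationRate {t : ℝ} (ht : 0 ≤ t) :
    HasDerivAt explorationRate
      (-(2 * Real.log (t + 1) * learningRate t) * explorationRate t ^ 2) t := by
  have hfun : explorationRate = fun s : ℝ => (1 + Real.log (s + 1) ^ 2)⁻¹ := by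
    funext s; rw [explorationRate, one_div]
  rw [hfun]
  have h := (((hasDerivAt_log_add_one ht).fun_pow 2).const_add 1).fun_inv
    (by positivity : (1 : ℝ) + Real.log (t + 1) ^ 2 ≠ 0)
  refine h.congr_deriv ?_
  rw [inv_pow]
  simp [div_eq_mul_inv]

lemma neg_learningRate_mul_le_deriv {t : ℝ} (ht : 0 ≤ t) :
    -(learningRate t * explorationRate t)
      ≤ -(2 * Real.log (t + 1) * learningRate t) * explorationRate t ^ 2 := by
  have h1 : 2 * Real.log (t + 1) * explorationRate t ≤ 1 := by
    rw [explorationRate, mul_one_div, div_le_one (by positivity)]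
    nlinarith [sq_nonneg (Real.log (t + 1) - 1)]
  have h2 := mul_le_mul_of_nonneg_left h1
    (mul_pos (learningRate_pos ht) (explorationRate_pos t)).le
  nlinarith

lemma tendsto_log_add_one : Tendsto (fun t : ℝ => Real.log (t + 1)) atTop atTop :=
  Real.tendsto_log_atTop.comp (tendsto_atTop_add_const_right _ _ tendsto_id)

/-- The learning rate decays faster than every power of the exploration rate. -/
lemma eventually_learningRate_lt {c : ℝ} (hc : 0 < c) (N : ℕ) :
    ∀ᶠ t in atTop, learningRate t < c * explorationRate t ^ N := by
  have h1 : ∀ᶠ t : ℝ in atTop,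
      ‖Real.log (t + 1) ^ (2 * N)‖ ≤ c / 2 ^ N / 2 * ‖t + 1‖ :=
    (tendsto_atTop_add_const_right _ (1 : ℝ) tendsto_id).eventually
      ((Real.isLittleO_pow_log_id_atTop (n := 2 * N)).def (by positivity))
  filter_upwards [h1, tendsto_log_add_one.eventually_ge_atTop 1, eventually_ge_atTop 0]
    with t h hL ht
  have ht1 : 0 < t + 1 := by linarith
  rw [Real.norm_of_nonneg (by positivity), Real.norm_of_nonneg ht1.le] at h
  have h2 : (1 + Real.log (t + 1) ^ 2) ^ N ≤ 2 ^ N * Real.log (t + 1) ^ (2 * N) := by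
    rw [pow_mul, ← mul_pow]
    exact pow_le_pow_left₀ (by positivity) (by nlinarith) N
  have h3 : 2 ^ N * Real.log (t + 1) ^ (2 * N) ≤ c / 2 * (t + 1) := by
    calc _ ≤ 2 ^ N * (c / 2 ^ N / 2 * (t + 1)) := by gcongr
      _ = _ := by field_simp
  rw [learningRate, explorationRate, div_pow, one_pow, mul_one_div,
    div_lt_div_iff₀ (by linarith) (by positivity)]
  nlinarith [mul_pos hc ht1]

/-! ### Softmax and exploration policies -/

variable {X A : Type*} [Fintype X] [Fintype A] [DecidableEq X] [DecidableEq A]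

lemma IsPolicy.le_one {f : X → A → ℝ} (hf : IsPolicy f) (x : X) (a : A) : f x a ≤ 1 := by
  rw [← hf.2 x]
  exact Finset.single_le_sum (fun b _ => hf.1 x b) (Finset.mem_univ a)

lemma IsPolicy.sum_mul_mem_Icc {f : X → A → ℝ} (hf : IsPolicy f) (x : X) {u : A → ℝ} {l b : ℝ}
    (hu : ∀ a, u a ∈ Set.Icc l b) : ∑ a, f x a * u a ∈ Set.Icc l b := by
  have h : ∀ c : ℝ, ∑ a, f x a * c = c := fun c => by rw [← Finset.sum_mul, hf.2, one_mul]
  constructor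
  · rw [← h l]
    exact Finset.sum_le_sum fun a _ => mul_le_mul_of_nonneg_left (hu a).1 (hf.1 x a)
  · rw [← h b]
    exact Finset.sum_le_sum fun a _ => mul_le_mul_of_nonneg_left (hu a).2 (hf.1 x a)

lemma IsPolicy.abs_sum_mul_le {f : X → A → ℝ} (hf : IsPolicy f) (x : X) {u : A → ℝ} {b : ℝ}
    (hu : ∀ a, |u a| ≤ b) : |∑ a, f x a * u a| ≤ b :=
  abs_le.2 (hf.sum_mul_mem_Icc x fun a => abs_le.1 (hu a))

variable [Nonempty A]

lemma sum_exp_pos (θ : X → A → ℝ) (x : X) : 0 < ∑ a, Real.exp (θ x a) :=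
  Finset.sum_pos (fun _ _ => Real.exp_pos _) Finset.univ_nonempty

lemma softmax_pos (θ : X → A → ℝ) (x : X) (a : A) : 0 < softmax θ x a :=
  div_pos (Real.exp_pos _) (sum_exp_pos θ x)

lemma isPolicy_softmax (θ : X → A → ℝ) : IsPolicy (softmax θ) :=
  ⟨fun x a => (softmax_pos θ x a).le, fun x => by
    simp only [softmax, ← Finset.sum_div]
    exact div_self (sum_exp_pos θ x).ne'⟩

lemma hasDerivWithinAt_softmax {θ : ℝ → X → A → ℝ} {θ' : X → A → ℝ} {s : Set ℝ} {t : ℝ}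
    (hθ : ∀ x a, HasDerivWithinAt (fun u => θ u x a) (θ' x a) s t) (x : X) (a : A) :
    HasDerivWithinAt (fun u => softmax (θ u) x a)
      (softmax (θ t) x a * (θ' x a - ∑ b, softmax (θ t) x b * θ' x b)) s t := by
  have hZ := HasDerivWithinAt.fun_sum (u := Finset.univ) fun b _ => (hθ x b).exp
  have h := (hθ x a).exp.div hZ (sum_exp_pos (θ t) x).ne'
  refine h.congr_deriv ?_
  have hZ0 := (sum_exp_pos (θ t) x).ne'
  simp only [softmax, div_mul_eq_mul_div, ← Finset.sum_div]
  field_simp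

lemma isPolicy_explore (t : ℝ) (θ : X → A → ℝ) : IsPolicy (explore t θ) := by
  refine ⟨fun x a => add_nonneg (div_nonneg (explorationRate_pos t).le (Nat.cast_nonneg _))
    (mul_nonneg (sub_nonneg.2 (explorationRate_le_one t)) (softmax_pos θ x a).le), fun x => ?_⟩
  have hA : (Fintype.card A : ℝ) ≠ 0 := Nat.cast_ne_zero.2 Fintype.card_ne_zero
  simp only [explore, Finset.sum_add_distrib, ← Finset.mul_sum, (isPolicy_softmax θ).2 x,
    Finset.sum_const, Finset.card_univ, nsmul_eq_mul]
  field_simp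
  ring

lemma explore_zero (θ : X → A → ℝ) (x : X) (a : A) :
    explore 0 θ x a = 1 / (Fintype.card A : ℝ) := by
  simp [explore, explorationRate]

lemma explorationRate_mul_le_explore (t : ℝ) (θ : X → A → ℝ) (x : X) (a : A) :
    explorationRate t * (1 / (Fintype.card A : ℝ)) ≤ explore t θ x a := by
  rw [mul_one_div]
  exact le_add_of_nonneg_right
    (mul_nonneg (sub_nonneg.2 (explorationRate_le_one t)) (softmax_pos θ x a).le)

lemma abs_explore_sub_softmax_le (t : ℝ) (θ : X → A → ℝ) (x : X) {u : A → ℝ} {b : ℝ}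
    (hu : ∀ a, |u a| ≤ b) :
    |∑ a, (explore t θ x a - softmax θ x a) * u a| ≤ 2 * b * explorationRate t := by
  have hA : (Fintype.card A : ℝ) ≠ 0 := Nat.cast_ne_zero.2 Fintype.card_ne_zero
  have h0 : IsPolicy (fun (_ : X) (_ : A) => 1 / (Fintype.card A : ℝ)) :=
    ⟨fun _ _ => by positivity, fun _ => by simp⟩
  have h1 := abs_le.1 (h0.abs_sum_mul_le x hu)
  have h2 := abs_le.1 ((isPolicy_softmax θ).abs_sum_mul_le x hu)
  have h3 : ∑ a, (explore t θ x a - softmax θ x a) * u a = explorationRate t *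
      (∑ a, 1 / (Fintype.card A : ℝ) * u a - ∑ a, softmax θ x a * u a) := by
    rw [← Finset.sum_sub_distrib, Finset.mul_sum]
    exact Finset.sum_congr rfl fun a _ => by rw [explore]; ring
  rw [h3, abs_mul, abs_of_pos (explorationRate_pos t), mul_comm]
  refine mul_le_mul_of_nonneg_right (abs_le.2 ⟨?_, ?_⟩) (explorationRate_pos t).le <;> linarith

/-! ### Stationary distributions of the exploration chains -/

lemma pow_mul_pow_apply_le {S : Type*} [Fintype S] [DecidableEq S] {P R : Matrix S S ℝ} {c : ℝ}
    (hc : 0 ≤ c) (hP : ∀ i j, 0 ≤ P i j) (h : ∀ i j, c * P i j ≤ R i j) (n : ℕ) (i j : S) :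
    0 ≤ (P ^ n) i j ∧ c ^ n * (P ^ n) i j ≤ (R ^ n) i j := by
  induction n generalizing j with
  | zero => simp [Matrix.one_apply]; split_ifs <;> simp
  | succ n ih =>
    simp only [pow_succ, Matrix.mul_apply]
    refine ⟨Finset.sum_nonneg fun k _ => mul_nonneg (ih k).1 (hP k j), ?_⟩
    rw [Finset.mul_sum]
    refine Finset.sum_le_sum fun k _ => ?_
    have h1 := mul_nonneg (pow_nonneg hc n) (ih k).1
    calc c ^ n * c * ((P ^ n) i k * P k j) = (c ^ n * (P ^ n) i k) * (c * P k j) := by ring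
      _ ≤ (R ^ n) i k * R k j :=
        mul_le_mul (ih k).2 (h k j) (mul_nonneg hc (hP k j)) (h1.trans (ih k).2)

/-- The stationary probabilities of the exploration chains are bounded below by a multiple of a
power of the exploration rate, uniformly in the parameter: entrywise these chains dominate
`η_t` times the chain of the uniform policy, which is the one at time `0`. -/
lemma MDP.IsErgodic.exists_le_stationary {M : MDP X A} (hM : M.IsErgodic) :
    ∃ c : ℝ, 0 < c ∧ ∃ N : ℕ, ∀ (t : ℝ) (θ : X → A → ℝ) (π : X × A → ℝ),
      IsStationaryDistribution (M.transition (explore t θ)) π →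
      ∀ s, c * explorationRate t ^ N ≤ π s := by
  have hX : Nonempty X := by
    by_contra h
    rw [not_nonempty_iff] at h
    simpa using M.μ_sum
  set P₀ := M.transition (explore 0 (0 : X → A → ℝ)) with hP₀
  have hnn : ∀ s s', 0 ≤ P₀ s s' := (M.transition_mem_rowStochastic (isPolicy_explore _ _)).1
  have hex : ∀ q : (X × A) × (X × A), ∃ k : ℕ, 0 < (P₀ ^ k) q.1 q.2 := fun q => by
    by_cases hS : Nontrivial (X × A)
    · obtain ⟨k, -, hk⟩ := (Matrix.isIrreducible_iff_exists_pow_pos hnn).1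
        (hM 0 le_rfl 0).1 q.1 q.2
      exact ⟨k, hk⟩
    · -- a one-point chain needs no step
      have := not_nontrivial_iff_subsingleton.1 hS
      exact ⟨0, by simp [Subsingleton.elim q.1 q.2]⟩
  choose k hk using hex
  obtain ⟨q₀, hq₀⟩ := Finite.exists_min fun q => (P₀ ^ k q) q.1 q.2
  obtain ⟨q₁, hq₁⟩ := Finite.exists_max k
  have hcard : 0 < (Fintype.card (X × A) : ℝ) := Nat.cast_pos.2 Fintype.card_pos
  refine ⟨1 / Fintype.card (X × A) * (P₀ ^ k q₀) q₀.1 q₀.2,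
    mul_pos (one_div_pos.2 hcard) (hk q₀), k q₁, fun t θ π ⟨hπ0, hπ1, hπ⟩ s => ?_⟩
  have hη := explorationRate_pos t
  -- some pair carries at least the average mass; the chain moves that mass on to `s`
  obtain ⟨s', hs'⟩ : ∃ s', 1 / (Fintype.card (X × A) : ℝ) ≤ π s' := by
    by_contra! h
    have := Finset.sum_lt_sum_of_nonempty Finset.univ_nonempty fun s (_ : s ∈ Finset.univ) => h s
    rw [hπ1, Finset.sum_const, Finset.card_univ, nsmul_eq_mul, mul_one_div_cancel hcard.ne'] at this
    exact lt_irrefl _ this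
  have hpow : ∀ n : ℕ, Matrix.vecMul π (M.transition (explore t θ) ^ n) = π := fun n => by
    induction n with
    | zero => simp
    | succ n ih => rw [pow_succ, ← Matrix.vecMul_vecMul, ih, hπ]
  have hle := pow_mul_pow_apply_le hη.le hnn (R := M.transition (explore t θ)) (fun i j => by
    simp only [hP₀, MDP.transition, Matrix.of_apply, explore_zero]
    have := mul_le_mul_of_nonneg_left (explorationRate_mul_le_explore t θ j.1 j.2)
      (M.p_nonneg i.1 i.2 j.1)
    linarith)
  have hnn' : ∀ i j, 0 ≤ (M.transition (explore t θ) ^ k (s', s)) i j := fun i j =>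
    (Matrix.mem_rowStochastic.1
      (pow_mem (M.transition_mem_rowStochastic (isPolicy_explore t θ)) _)).1 i j
  calc 1 / (Fintype.card (X × A) : ℝ) * (P₀ ^ k q₀) q₀.1 q₀.2 * explorationRate t ^ k q₁
      ≤ 1 / (Fintype.card (X × A) : ℝ) * (P₀ ^ k (s', s)) s' s
          * explorationRate t ^ k (s', s) := by
        refine mul_le_mul (mul_le_mul_of_nonneg_left (hq₀ (s', s)) (by positivity))
          (pow_le_pow_of_le_one hη.le (explorationRate_le_one t) (hq₁ _)) (by positivity)
          (mul_nonneg (by positivity) (hk (s', s)).le)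
    _ = 1 / (Fintype.card (X × A) : ℝ) *
          (explorationRate t ^ k (s', s) * (P₀ ^ k (s', s)) s' s) := by ring
    _ ≤ π s' * (M.transition (explore t θ) ^ k (s', s)) s' s :=
        mul_le_mul hs' (hle _ _ _).2 (mul_nonneg (by positivity) (hk (s', s)).le) (hπ0 s')
    _ ≤ ∑ i, π i * (M.transition (explore t θ) ^ k (s', s)) i s :=
        Finset.single_le_sum (f := fun i => π i * (M.transition (explore t θ) ^ k (s', s)) i s)
          (fun i _ => mul_nonneg (hπ0 i) (hnn' i s)) (Finset.mem_univ s')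
    _ = π s := congrFun (hpow _) s

/-! ### The values along the actor flow -/

/-- Advantage of the action `a` over the policy `f` in the state `x`, for the action values `q`. -/
def advantage (f q : X → A → ℝ) (x : X) (a : A) : ℝ :=
  q x a - ∑ b, f x b * q x b

lemma IsPolicy.sum_mul_advantage {f : X → A → ℝ} (hf : IsPolicy f) (q : X → A → ℝ) (x : X) :
    ∑ a, f x a * advantage f q x a = 0 := by
  simp only [advantage, mul_sub, Finset.sum_sub_distrib, ← Finset.sum_mul, hf.2, one_mul, sub_self]

lemma IsPolicy.abs_advantage_le {f q : X → A → ℝ} (hf : IsPolicy f) {x : X} {b : ℝ}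
    (hq : ∀ a, |q x a| ≤ b) (a : A) : |advantage f q x a| ≤ 2 * b := by
  have h := hf.abs_sum_mul_le x hq
  calc _ ≤ |q x a| + |∑ b, f x b * q x b| := abs_sub _ _
    _ ≤ _ := by linarith [hq a]

lemma advantage_sub (f q q' : X → A → ℝ) (x : X) (a : A) :
    advantage f (q - q') x a = advantage f q x a - advantage f q' x a := by
  simp only [advantage, Pi.sub_apply, mul_sub, Finset.sum_sub_distrib]
  ring

namespace MDP

lemma advantage_actionValue (M : MDP X A) {f : X → A → ℝ} (hf : IsPolicy f) (x : X) (a : A) :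
    advantage f (M.actionValue f) x a = M.actionValue f x a - M.stateValue f x := by
  rw [advantage, M.stateValue_eq hf]

lemma isPolicy_transition (M : MDP X A) (x : X) (a : A) :
    IsPolicy fun (_ : Unit) z => M.p x a z :=
  ⟨fun _ z => M.p_nonneg x a z, fun _ => M.p_sum x a⟩

lemma abs_actionValue_le (M : MDP X A) (hr : ∀ x a, 0 ≤ M.r x a ∧ M.r x a ≤ 1) {f : X → A → ℝ}
    (hf : IsPolicy f) (x : X) (a : A) : |M.actionValue f x a| ≤ (1 - M.γ)⁻¹ := by
  have h := M.actionValue_mem_Icc hr hf x a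
  rw [abs_of_nonneg h.1]
  exact h.2

/-- Derivative of the state values `V^f` with respect to the rescaled time `log (1 + t)` when the
actor, at the softmax policy `f`, is driven by the critic `Q`. -/
def valueSlope (M : MDP X A) (κ : ℝ) (f Q : X → A → ℝ) (x : X) : ℝ :=
  κ * ∑ z, M.resolvent f x z * (M.stateOccupancy f z *
    ∑ a, f z a * (f z a * (advantage f Q z a * advantage f (M.actionValue f) z a)))

lemma abs_valueSlope_le (M : MDP X A) (hr : ∀ x a, 0 ≤ M.r x a ∧ M.r x a ≤ 1) {κ C : ℝ}
    (hκ : 0 < κ) {f Q : X → A → ℝ} (hf : IsPolicy f) (hQ : ∀ x a, |Q x a| ≤ C) (x : X) :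
    |M.valueSlope κ f Q x|
      ≤ κ * ((1 - M.γ)⁻¹ * ((1 - M.γ)⁻¹ * (2 * C * (2 * (1 - M.γ)⁻¹)))) := by
  have h0 : 0 < (1 - M.γ)⁻¹ := inv_pos.2 M.one_sub_discount_pos
  have hC : 0 ≤ C := (abs_nonneg _).trans (hQ x (Classical.arbitrary A))
  rw [valueSlope, abs_mul, abs_of_pos hκ]
  refine mul_le_mul_of_nonneg_left ?_ hκ.le
  rw [← M.sum_resolvent hf x, Finset.sum_mul, M.sum_resolvent hf x]
  refine (Finset.abs_sum_le_sum_abs _ _).trans (Finset.sum_le_sum fun z _ => ?_)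
  rw [abs_mul, abs_of_nonneg (M.resolvent_nonneg hf x z), abs_mul,
    abs_of_nonneg (M.stateOccupancy_nonneg hf z)]
  refine mul_le_mul_of_nonneg_left ?_ (M.resolvent_nonneg hf x z)
  refine mul_le_mul (M.stateOccupancy_le hf z) ?_ (abs_nonneg _) h0.le
  refine hf.abs_sum_mul_le z fun a => ?_
  rw [abs_mul, abs_of_nonneg (hf.1 z a), abs_mul]
  exact (mul_le_of_le_one_left (by positivity) (hf.le_one z a)).trans
    (mul_le_mul (hf.abs_advantage_le (hQ z) a)
      (hf.abs_advantage_le (M.abs_actionValue_le hr hf z) a) (abs_nonneg _) (by positivity))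

/-- The actor increases each state value at a rate proportional to the squared advantages in that
state, up to the square of the error `E` of the critic. -/
lemma le_valueSlope (M : MDP X A) {κ m E : ℝ} (hκ : 0 < κ) (hm : 0 ≤ m) (hμ : ∀ x, m ≤ M.μ x)
    {f Q : X → A → ℝ} (hf : IsPolicy f) (hQ : ∀ x a, |Q x a - M.actionValue f x a| ≤ E) (x : X) :
    κ * m / 2 * ∑ a, (f x a * (M.actionValue f x a - M.stateValue f x)) ^ 2
      - 2 * κ * (1 - M.γ)⁻¹ ^ 2 * E ^ 2 ≤ M.valueSlope κ f Q x := by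
  set q := M.actionValue f
  set F : X → ℝ := fun z => ∑ a, (f z a * advantage f q z a) ^ 2 with hF
  have hFnn : ∀ z, 0 ≤ F z := fun z => Finset.sum_nonneg fun a _ => sq_nonneg _
  have h1 : ∀ z, F z / 2 - 2 * E ^ 2
      ≤ ∑ a, f z a * (f z a * (advantage f Q z a * advantage f q z a)) := fun z => by
    have h2E : ∀ a, |advantage f Q z a - advantage f q z a| ≤ 2 * E := fun a => by
      rw [← advantage_sub]
      exact hf.abs_advantage_le (fun a => hQ z a) a
    have h3 : ∑ a, f z a * (2 * E ^ 2) = 2 * E ^ 2 := by rw [← Finset.sum_mul, hf.2, one_mul]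
    rw [← h3, hF, Finset.sum_div, ← Finset.sum_sub_distrib]
    refine Finset.sum_le_sum fun a _ => ?_
    have h4 : (advantage f Q z a - advantage f q z a) ^ 2 ≤ (2 * E) ^ 2 :=
      sq_le_sq' (abs_le.1 (h2E a)).1 (abs_le.1 (h2E a)).2
    have h5 : advantage f q z a ^ 2 / 2 - 2 * E ^ 2 ≤ advantage f Q z a * advantage f q z a := by
      nlinarith [sq_nonneg (advantage f Q z a)]
    have h6 : f z a * f z a * (2 * E ^ 2) ≤ f z a * (2 * E ^ 2) :=
      mul_le_mul_of_nonneg_right (mul_le_of_le_one_left (hf.1 z a) (hf.le_one z a))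
        (by positivity)
    nlinarith [mul_le_mul_of_nonneg_left h5 (mul_nonneg (hf.1 z a) (hf.1 z a))]
  have h0 : 0 < (1 - M.γ)⁻¹ := inv_pos.2 M.one_sub_discount_pos
  have h2 : ∀ z, m * F z / 2 - 2 * (1 - M.γ)⁻¹ * E ^ 2 ≤ M.stateOccupancy f z *
      ∑ a, f z a * (f z a * (advantage f Q z a * advantage f q z a)) := fun z => by
    have hd := M.stateOccupancy_nonneg hf z
    have := mul_le_mul_of_nonneg_left (h1 z) hd
    have hdm := mul_le_mul_of_nonneg_right ((hμ z).trans (M.le_stateOccupancy hf z)) (hFnn z)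
    have hdE := mul_le_mul_of_nonneg_right (M.stateOccupancy_le hf z) (sq_nonneg E)
    nlinarith
  have h3 : m * F x / 2 - 2 * (1 - M.γ)⁻¹ ^ 2 * E ^ 2
      ≤ ∑ z, M.resolvent f x z * (m * F z / 2 - 2 * (1 - M.γ)⁻¹ * E ^ 2) := by
    have ha : m * F x / 2 ≤ ∑ z, M.resolvent f x z * (m * F z / 2) := by
      have hnn : ∀ z, 0 ≤ m * F z / 2 := fun z => div_nonneg (mul_nonneg hm (hFnn z)) two_pos.le
      refine le_trans ?_ (Finset.single_le_sum (f := fun z => M.resolvent f x z * (m * F z / 2))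
        (fun z _ => mul_nonneg (M.resolvent_nonneg hf x z) (hnn z)) (Finset.mem_univ x))
      exact le_mul_of_one_le_left (hnn x) (M.one_le_resolvent_self hf x)
    have hb : ∑ z, M.resolvent f x z * (2 * (1 - M.γ)⁻¹ * E ^ 2)
        = 2 * (1 - M.γ)⁻¹ ^ 2 * E ^ 2 := by
      rw [← Finset.sum_mul, M.sum_resolvent hf]; ring
    simp only [mul_sub, Finset.sum_sub_distrib]
    rw [hb]
    linarith
  have h4 := h3.trans (Finset.sum_le_sum fun z _ =>
    mul_le_mul_of_nonneg_left (h2 z) (M.resolvent_nonneg hf x z))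
  have h5 := mul_le_mul_of_nonneg_left h4 hκ.le
  rw [valueSlope]
  refine le_trans (le_of_eq ?_) h5
  simp only [hF, q, M.advantage_actionValue hf]
  ring

lemma IsLimitSolution.hasDerivWithinAt_actor {M : MDP X A} {α κ : ℝ} {Q θ : ℝ → X → A → ℝ}
    (h : M.IsLimitSolution α κ Q θ) {t : ℝ} (ht : 0 ≤ t) (x : X) (a : A) :
    HasDerivWithinAt (fun s => θ s x a)
      (learningRate t * κ * M.stateOccupancy (softmax (θ t)) x *
        (softmax (θ t) x a * advantage (softmax (θ t)) (Q t) x a)) (Set.Ici 0) t := by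
  obtain ⟨π, hπ⟩ := h
  refine (((hπ t ht).2 x a).2).congr_deriv ?_
  rw [M.visitingMeasure_eq (isPolicy_softmax _), advantage]
  simp only [mul_comm (Q t x _)]
  ring

lemma IsLimitSolution.hasDerivWithinAt_stateValue {M : MDP X A} {α κ : ℝ}
    {Q θ : ℝ → X → A → ℝ} (h : M.IsLimitSolution α κ Q θ) {t : ℝ} (ht : 0 ≤ t) (x : X) :
    HasDerivWithinAt (fun s => M.stateValue (softmax (θ s)) x)
      (learningRate t * M.valueSlope κ (softmax (θ t)) (Q t) x) (Set.Ici 0) t := by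
  have hf := isPolicy_softmax (θ t)
  refine (M.hasDerivWithinAt_stateValue (fun u => isPolicy_softmax (θ u)) (fun x a =>
    hasDerivWithinAt_softmax (fun x a => h.hasDerivWithinAt_actor ht x a) x a) x).congr_deriv ?_
  rw [valueSlope, Finset.mul_sum, Finset.mul_sum]
  refine Finset.sum_congr rfl fun z _ => ?_
  set f := softmax (θ t)
  set q := M.actionValue f
  set c := learningRate t * κ * M.stateOccupancy f z
  -- the mean of the parameter velocity is orthogonal to the advantages, not to the action values
  have key : ∑ a, f z a * (c * (f z a * advantage f (Q t) z a)
      - ∑ b, f z b * (c * (f z b * advantage f (Q t) z b))) * q z a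
      = c * ∑ a, f z a * (f z a * (advantage f (Q t) z a * advantage f q z a)) := by
    set S := ∑ b, f z b * (c * (f z b * advantage f (Q t) z b)) with hS
    have e1 : ∑ a, f z a * (c * (f z a * advantage f (Q t) z a) - S) * q z a
        = ∑ a, f z a * (c * (f z a * advantage f (Q t) z a)) * q z a
          - S * ∑ a, f z a * q z a := by
      rw [Finset.mul_sum, ← Finset.sum_sub_distrib]
      exact Finset.sum_congr rfl fun a _ => by ring
    rw [e1, hS, Finset.sum_mul, ← Finset.sum_sub_distrib, Finset.mul_sum]
    exact Finset.sum_congr rfl fun a _ => by rw [advantage, advantage]; ring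
  rw [key]
  ring

lemma IsLimitSolution.hasDerivWithinAt_actionValue {M : MDP X A} {α κ : ℝ}
    {Q θ : ℝ → X → A → ℝ} (h : M.IsLimitSolution α κ Q θ) {t : ℝ} (ht : 0 ≤ t) (x : X) (a : A) :
    HasDerivWithinAt (fun s => M.actionValue (softmax (θ s)) x a)
      (learningRate t *
        (M.γ * ∑ z, M.p x a z * M.valueSlope κ (softmax (θ t)) (Q t) z)) (Set.Ici 0) t := by
  simp only [M.actionValue_bellman (isPolicy_softmax _)]
  refine (((HasDerivWithinAt.fun_sum (u := Finset.univ) fun z _ =>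
    (h.hasDerivWithinAt_stateValue ht z).const_mul (M.p x a z)).const_mul M.γ).const_add
      (M.r x a)).congr_deriv ?_
  simp only [Finset.mul_sum]
  exact Finset.sum_congr rfl fun z _ => by ring

/-! ### Convergence of the critic -/

lemma backup_eq (M : MDP X A) (Q g : X → A → ℝ) (x : X) (a : A) :
    ∑ z, ∑ a'', Q z a'' * g z a'' * M.p x a z = ∑ z, M.p x a z * ∑ b, g z b * Q z b := by
  simp only [Finset.mul_sum]
  exact Finset.sum_congr rfl fun z _ => Finset.sum_congr rfl fun b _ => by ring

lemma IsLimitSolution.exists_abs_critic_le {M : MDP X A}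
    (hr : ∀ x a, 0 ≤ M.r x a ∧ M.r x a ≤ 1) (hM : M.IsErgodic) {α κ : ℝ} (hα : 0 < α)
    {Q θ : ℝ → X → A → ℝ} (h : M.IsLimitSolution α κ Q θ) :
    ∃ C, ∀ t, 0 ≤ t → ∀ x a, |Q t x a| ≤ C := by
  obtain ⟨π, hπ⟩ := h
  obtain ⟨c, hc, N, hcN⟩ := hM.exists_le_stationary
  have hγ := M.one_sub_discount_pos
  have hπpos : ∀ t, 0 ≤ t → ∀ s, 0 < π t s := fun t ht s =>
    (mul_pos hc (pow_pos (explorationRate_pos t) N)).trans_le (hcN t (θ t) (π t) (hπ t ht).1 s)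
  set C := ‖Q 0‖ + 1 + (1 - M.γ)⁻¹ with hC
  have hCγ : 1 < (1 - M.γ) * C := by
    have h1 : (1 - M.γ) * (1 - M.γ)⁻¹ = 1 := mul_inv_cancel₀ hγ.ne'
    have h2 : 0 < (1 - M.γ) * (‖Q 0‖ + 1) := by positivity
    rw [hC]; nlinarith
  refine ⟨C, fun t ht x a => abs_le_of_relaxation (ι := X × A) (T := 0)
    (e := fun s t => Q t s.1 s.2) (m := fun s t => α * π t s)
    (w := fun s t => M.r s.1 s.2
      + M.γ * ∑ z, M.p s.1 s.2 z * ∑ b, explore t (θ t) z b * Q t z b)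
    (ρ := fun _ _ => 0) (B := fun _ => C) (B' := fun _ => 0) le_rfl ?_ ?_ ?_ ?_ ?_ ht (x, a)⟩
  · intro s t ht
    refine ((hπ t ht).2 s.1 s.2).1.congr_deriv ?_
    rw [M.backup_eq, add_zero]
  · exact fun t _ => hasDerivWithinAt_const _ _ _
  · exact fun s t ht => (mul_pos hα (hπpos t ht s)).le
  · intro s
    have h1 : |Q 0 s.1 s.2| ≤ ‖Q 0‖ := (norm_le_pi_norm (Q 0 s.1) s.2).trans
      (norm_le_pi_norm (Q 0) s.1)
    have h2 := inv_pos.2 hγ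
    change |Q 0 s.1 s.2| ≤ C
    linarith
  · intro t ht hall s
    have h1 : |∑ z, M.p s.1 s.2 z * ∑ b, explore t (θ t) z b * Q t z b| ≤ C :=
      (M.isPolicy_transition s.1 s.2).abs_sum_mul_le () fun z =>
        (isPolicy_explore t (θ t)).abs_sum_mul_le z fun b => hall (z, b)
    have h2 := abs_add_le (M.r s.1 s.2)
      (M.γ * ∑ z, M.p s.1 s.2 z * ∑ b, explore t (θ t) z b * Q t z b)
    rw [abs_mul, abs_of_pos M.γ_pos, abs_of_nonneg (hr s.1 s.2).1] at h2
    have h3 := mul_le_mul_of_nonneg_left h1 M.γ_pos.le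
    have h4 := (hr s.1 s.2).2
    rw [abs_zero, add_zero]
    exact mul_neg_of_pos_of_neg (mul_pos hα (hπpos t ht s)) (by linarith)

/-- The critic tracks the action values of the current policy with an error of the order of the
exploration rate. -/
lemma IsLimitSolution.exists_abs_critic_sub_le {M : MDP X A}
    (hr : ∀ x a, 0 ≤ M.r x a ∧ M.r x a ≤ 1) (hM : M.IsErgodic) {α κ : ℝ} (hα : 0 < α) (hκ : 0 < κ)
    {Q θ : ℝ → X → A → ℝ} (h : M.IsLimitSolution α κ Q θ) :
    ∃ K T, 0 ≤ T ∧ ∀ t, T ≤ t → ∀ x a,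
      |Q t x a - M.actionValue (softmax (θ t)) x a| ≤ K * explorationRate t := by
  obtain ⟨C, hC⟩ := h.exists_abs_critic_le hr hM hα
  have hderiv := fun t (ht : 0 ≤ t) x a => h.hasDerivWithinAt_actionValue ht x a
  obtain ⟨π, hπ⟩ := h
  obtain ⟨c, hc, N, hcN⟩ := hM.exists_le_stationary
  have hγ := M.one_sub_discount_pos
  set D := (1 - M.γ)⁻¹ with hD
  have hDpos : 0 < D := inv_pos.2 hγ
  have hDγ : (1 - M.γ) * D = 1 := mul_inv_cancel₀ hγ.ne'
  set C₁ := |κ * (D * (D * (2 * C * (2 * D))))| with hC₁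
  -- after `T` the learning rate is negligible against the relaxation rate of the critic
  obtain ⟨T, hT⟩ := eventually_atTop.1 ((eventually_learningRate_lt
    (by positivity : 0 < α * c * (1 - M.γ) / 2 / (C₁ + 1)) (N + 1)).and (eventually_ge_atTop 0))
  have hT0 : 0 ≤ T := (hT T le_rfl).2
  have hηT := explorationRate_pos T
  set K := 1 + 4 * D ^ 2 + (|C| + D) / explorationRate T with hK
  have hK1 : 1 ≤ K := by
    have : 0 ≤ 4 * D ^ 2 + (|C| + D) / explorationRate T := by positivity
    linarith
  have hK2 : 4 * D ≤ (1 - M.γ) * K := by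
    have h1 : 0 ≤ (1 - M.γ) * (1 + (|C| + D) / explorationRate T) := by positivity
    have h2 : (1 - M.γ) * K
        = (1 - M.γ) * (1 + (|C| + D) / explorationRate T) + ((1 - M.γ) * D) * (4 * D) := by
      rw [hK]; ring
    rw [h2, hDγ]; linarith
  have hK3 : |C| + D ≤ K * explorationRate T := by
    rw [← div_le_iff₀ hηT]
    have : 0 ≤ 1 + 4 * D ^ 2 := by positivity
    linarith
  refine ⟨K, T, hT0, fun t ht x a => abs_le_of_relaxation (ι := X × A) (T := T)
    (e := fun s t => Q t s.1 s.2 - M.actionValue (softmax (θ t)) s.1 s.2)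
    (m := fun s t => α * π t s)
    (w := fun s t =>
      M.γ * (∑ z, M.p s.1 s.2 z * ∑ b, explore t (θ t) z b *
        (Q t z b - M.actionValue (softmax (θ t)) z b)
      + ∑ z, M.p s.1 s.2 z * ∑ b, (explore t (θ t) z b - softmax (θ t) z b) *
        M.actionValue (softmax (θ t)) z b))
    (ρ := fun s t => -(learningRate t *
        (M.γ * ∑ z, M.p s.1 s.2 z * M.valueSlope κ (softmax (θ t)) (Q t) z)))
    (B := fun t => K * explorationRate t)
    (B' := fun t => K * (-(2 * Real.log (t + 1) * learningRate t) * explorationRate t ^ 2))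
    hT0 ?_ ?_ ?_ ?_ ?_ ht (x, a)⟩
  · intro s t ht
    have ht0 := hT0.trans ht
    refine (((hπ t ht0).2 s.1 s.2).1.sub (hderiv t ht0 s.1 s.2)).congr_deriv ?_
    have hb := M.actionValue_bellman (isPolicy_softmax (θ t)) s.1 s.2
    simp only [M.stateValue_eq (isPolicy_softmax (θ t))] at hb
    rw [M.backup_eq]
    simp only [mul_sub, sub_mul, Finset.sum_sub_distrib]
    linear_combination (-(α * π t s)) * hb
  · exact fun t ht => ((hasDerivAt_explorationRate (hT0.trans ht)).const_mul K).hasDerivWithinAt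
  · exact fun s t ht => mul_nonneg hα.le ((hπ t (hT0.trans ht)).1.1 s)
  · intro s
    have h1 := abs_sub (Q T s.1 s.2) (M.actionValue (softmax (θ T)) s.1 s.2)
    have h2 := M.abs_actionValue_le hr (isPolicy_softmax (θ T)) s.1 s.2
    have h3 := hC T hT0 s.1 s.2
    have h4 := le_abs_self C
    change |Q T s.1 s.2 - M.actionValue (softmax (θ T)) s.1 s.2| ≤ K * explorationRate T
    linarith
  · intro t ht hall s
    have ht0 := hT0.trans ht
    have hζ := learningRate_pos ht0
    have hη := explorationRate_pos t
    have hf := isPolicy_softmax (θ t)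
    have hw1 : |∑ z, M.p s.1 s.2 z * ∑ b, explore t (θ t) z b *
        (Q t z b - M.actionValue (softmax (θ t)) z b)| ≤ K * explorationRate t :=
      (M.isPolicy_transition s.1 s.2).abs_sum_mul_le () fun z =>
        (isPolicy_explore t (θ t)).abs_sum_mul_le z fun b => hall (z, b)
    have hw2 : |∑ z, M.p s.1 s.2 z * ∑ b, (explore t (θ t) z b - softmax (θ t) z b) *
        M.actionValue (softmax (θ t)) z b| ≤ 2 * D * explorationRate t :=
      (M.isPolicy_transition s.1 s.2).abs_sum_mul_le () fun z =>
        abs_explore_sub_softmax_le t (θ t) z (M.abs_actionValue_le hr hf z)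
    have hρ : |∑ z, M.p s.1 s.2 z * M.valueSlope κ (softmax (θ t)) (Q t) z| ≤ C₁ :=
      (M.isPolicy_transition s.1 s.2).abs_sum_mul_le () fun z =>
        (M.abs_valueSlope_le hr hκ hf (hC t ht0) z).trans (le_abs_self _)
    have hdB := mul_le_mul_of_nonneg_left (neg_learningRate_mul_le_deriv ht0)
      (zero_le_one.trans hK1)
    refine lt_of_lt_of_le ?_ hdB
    have hrate := (hT t ht).1
    have hπs := hcN t (θ t) (π t) (hπ t ht0).1 s
    have hη1 := explorationRate_le_one t
    have hγ0 := M.γ_pos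
    have hγ1 := M.γ_lt_one
    generalize ∑ z, M.p s.1 s.2 z * ∑ b, explore t (θ t) z b *
        (Q t z b - M.actionValue (softmax (θ t)) z b) = w₁ at *
    generalize ∑ z, M.p s.1 s.2 z * ∑ b, (explore t (θ t) z b - softmax (θ t) z b) *
        M.actionValue (softmax (θ t)) z b = w₂ at *
    generalize ∑ z, M.p s.1 s.2 z * M.valueSlope κ (softmax (θ t)) (Q t) z = σ at *
    have hC₁0 : 0 ≤ C₁ := abs_nonneg _
    generalize explorationRate t = η at *
    generalize learningRate t = ζ at *
    have e1 : |M.γ * (w₁ + w₂)| ≤ M.γ * (K * η) + 2 * D * η := by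
      rw [abs_mul, abs_of_pos hγ0]
      have := abs_add_le w₁ w₂
      have h2 : M.γ * (2 * D * η) ≤ 2 * D * η := mul_le_of_le_one_left (by positivity) hγ1.le
      nlinarith
    have e2 : |-(ζ * (M.γ * σ))| ≤ C₁ * ζ := by
      rw [abs_neg, abs_mul, abs_mul, abs_of_pos hζ, abs_of_pos hγ0, mul_comm]
      exact mul_le_mul_of_nonneg_right
        ((mul_le_of_le_one_left (abs_nonneg _) hγ1.le).trans hρ) hζ.le
    have e3 : |M.γ * (w₁ + w₂)| - K * η ≤ -((1 - M.γ) * K / 2 * η) := by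
      nlinarith [mul_le_mul_of_nonneg_right hK2 hη.le]
    have e4 : α * π t s * (|M.γ * (w₁ + w₂)| - K * η)
        ≤ -(K * (α * c * (1 - M.γ) / 2 * η ^ (N + 1))) := by
      have hm : α * (c * η ^ N) ≤ α * π t s := mul_le_mul_of_nonneg_left hπs hα.le
      have hm0 : 0 ≤ α * (c * η ^ N) := by positivity
      have h1 := mul_le_mul_of_nonneg_left e3 (hm0.trans hm)
      have h2 := mul_le_mul_of_nonneg_right hm
        (by positivity : 0 ≤ (1 - M.γ) * K / 2 * η)
      have h3 : α * (c * η ^ N) * ((1 - M.γ) * K / 2 * η)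
          = K * (α * c * (1 - M.γ) / 2 * η ^ (N + 1)) := by ring
      linarith
    have e5 : (C₁ + 1) * ζ < α * c * (1 - M.γ) / 2 * η ^ (N + 1) := by
      rw [div_mul_eq_mul_div, lt_div_iff₀ (by positivity)] at hrate
      linarith
    have e6 := mul_lt_mul_of_pos_left e5 (zero_lt_one.trans_le hK1)
    have e7 : C₁ * ζ ≤ K * (C₁ * ζ) := le_mul_of_one_le_left (by positivity) hK1
    have e8 : K * (ζ * η) ≤ K * ζ :=
      mul_le_mul_of_nonneg_left (mul_le_of_le_one_right hζ.le hη1) (zero_le_one.trans hK1)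
    nlinarith

end MDP

/-! ### Convergence of the state values -/

lemma explorationRate_le_inv_sq {t : ℝ} (h : 1 ≤ Real.log (t + 1)) :
    explorationRate t ≤ 1 / Real.log (t + 1) ^ 2 :=
  one_div_le_one_div_of_le (by positivity) (by linarith)

lemma tendsto_explorationRate : Tendsto explorationRate atTop (𝓝 0) := by
  unfold explorationRate
  have h : Tendsto (fun t : ℝ => 1 + Real.log (t + 1) ^ 2) atTop atTop :=
    tendsto_atTop_add_const_left _ _
      ((tendsto_pow_atTop two_ne_zero).comp tendsto_log_add_one)
  simp only [one_div]
  exact h.inv_tendsto_atTop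

lemma hasDerivAt_div_log_add_one (C : ℝ) {t : ℝ} (ht : 0 ≤ t) (hL : 1 ≤ Real.log (t + 1)) :
    HasDerivAt (fun s : ℝ => C / Real.log (s + 1))
      (-(learningRate t * (C / Real.log (t + 1) ^ 2))) t := by
  have hL0 : Real.log (t + 1) ≠ 0 := (zero_lt_one.trans_le hL).ne'
  refine ((hasDerivAt_const t C).fun_div (hasDerivAt_log_add_one ht) hL0).congr_deriv ?_
  field_simp
  ring

lemma exists_tendsto_of_monotoneOn_Ici {g : ℝ → ℝ} {T b : ℝ} (hg : MonotoneOn g (Set.Ici T))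
    (hb : ∀ t, T ≤ t → g t ≤ b) : ∃ l, Tendsto g atTop (𝓝 l) := by
  have hmono : Monotone fun t => g (max t T) := fun s t hst =>
    hg (Set.mem_Ici.2 (le_max_right _ _)) (Set.mem_Ici.2 (le_max_right _ _)) (max_le_max_right T hst)
  refine ⟨_, (tendsto_atTop_ciSup hmono ⟨b, ?_⟩).congr' ?_⟩
  · rintro _ ⟨t, rfl⟩
    exact hb _ (le_max_right _ _)
  · filter_upwards [eventually_ge_atTop T] with t ht
    rw [max_eq_left ht]

namespace MDP

/-- `le_valueSlope` along a solution, with the error of the critic made explicit; the bound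
`1 / log ^ 2` on its square is weaker than what holds but enough for the rate. -/
lemma IsLimitSolution.exists_le_valueSlope {M : MDP X A}
    (hr : ∀ x a, 0 ≤ M.r x a ∧ M.r x a ≤ 1) (hM : M.IsErgodic) {α κ : ℝ} (hα : 0 < α) (hκ : 0 < κ)
    {Q θ : ℝ → X → A → ℝ} (h : M.IsLimitSolution α κ Q θ) (hμ : ∀ x, 0 < M.μ x) :
    ∃ c C T : ℝ, 0 < c ∧ 0 ≤ C ∧ 0 ≤ T ∧ ∀ t, T ≤ t → 1 ≤ Real.log (t + 1) ∧ ∀ x,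
      c * ∑ a, (softmax (θ t) x a * (M.actionValue (softmax (θ t)) x a
          - M.stateValue (softmax (θ t)) x)) ^ 2 - C / Real.log (t + 1) ^ 2
        ≤ M.valueSlope κ (softmax (θ t)) (Q t) x := by
  obtain ⟨K, T₀, hT₀, hK⟩ := h.exists_abs_critic_sub_le hr hM hα hκ
  obtain ⟨T₁, hT₁⟩ := eventually_atTop.1 (tendsto_log_add_one.eventually_ge_atTop 1)
  obtain ⟨m, hm, hmμ⟩ : ∃ m, 0 < m ∧ ∀ x, m ≤ M.μ x := by
    have hX : Nonempty X := by
      by_contra h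
      rw [not_nonempty_iff] at h
      simpa using M.μ_sum
    obtain ⟨x₀, hx₀⟩ := Finite.exists_min M.μ
    exact ⟨M.μ x₀, hμ x₀, hx₀⟩
  refine ⟨κ * m / 2, 2 * κ * (1 - M.γ)⁻¹ ^ 2 * K ^ 2, max T₀ T₁, by positivity, by positivity,
    hT₀.trans (le_max_left _ _), fun t ht => ⟨hT₁ t ((le_max_right _ _).trans ht), fun x => ?_⟩⟩
  have hL := hT₁ t ((le_max_right _ _).trans ht)
  refine le_trans (sub_le_sub_left ?_ _) (M.le_valueSlope hκ hm.le hmμ (isPolicy_softmax _)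
    (hK t ((le_max_left _ _).trans ht)) x)
  have hη : explorationRate t ^ 2 ≤ 1 / Real.log (t + 1) ^ 2 := by
    refine le_trans ?_ (explorationRate_le_inv_sq hL)
    nlinarith [explorationRate_pos t, explorationRate_le_one t]
  calc _ = 2 * κ * (1 - M.γ)⁻¹ ^ 2 * K ^ 2 * explorationRate t ^ 2 := by ring
    _ ≤ 2 * κ * (1 - M.γ)⁻¹ ^ 2 * K ^ 2 * (1 / Real.log (t + 1) ^ 2) :=
      mul_le_mul_of_nonneg_left hη (by positivity)
    _ = _ := by rw [mul_one_div]

/-- Every state value converges, since it increases up to an error which is integrable in the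
rescaled time `log (1 + t)`. -/
lemma IsLimitSolution.exists_tendsto_stateValue {M : MDP X A}
    (hr : ∀ x a, 0 ≤ M.r x a ∧ M.r x a ≤ 1) (hM : M.IsErgodic) {α κ : ℝ} (hα : 0 < α) (hκ : 0 < κ)
    {Q θ : ℝ → X → A → ℝ} (h : M.IsLimitSolution α κ Q θ) (hμ : ∀ x, 0 < M.μ x) :
    ∃ v : X → ℝ, ∀ x, Tendsto (fun t => M.stateValue (softmax (θ t)) x) atTop (𝓝 (v x)) := by
  obtain ⟨c, C, T, hc, hC, hT, hslope⟩ := h.exists_le_valueSlope hr hM hα hκ hμ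
  suffices H : ∀ x, ∃ l, Tendsto (fun t => M.stateValue (softmax (θ t)) x) atTop (𝓝 l) by
    choose v hv using H
    exact ⟨v, hv⟩
  intro x
  have hmono := monotoneOn_Ici_of_hasDerivWithinAt hT
    (fun t ht => (h.hasDerivWithinAt_stateValue (hT.trans ht) x).sub
      (hasDerivAt_div_log_add_one C (hT.trans ht) (hslope t ht).1).hasDerivWithinAt)
    (fun t ht => by
      have h1 := (hslope t ht).2 x
      have h2 : 0 ≤ c * ∑ a, (softmax (θ t) x a * (M.actionValue (softmax (θ t)) x a
          - M.stateValue (softmax (θ t)) x)) ^ 2 :=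
        mul_nonneg hc.le (Finset.sum_nonneg fun a _ => sq_nonneg _)
      rw [sub_neg_eq_add, ← mul_add]
      exact mul_nonneg (learningRate_pos (hT.trans ht)).le (by linarith))
  obtain ⟨l, hl⟩ := exists_tendsto_of_monotoneOn_Ici (b := (1 - M.γ)⁻¹) hmono fun t ht => by
    have h1 := (M.stateValue_mem_Icc hr (isPolicy_softmax (θ t)) x).2
    have h2 : 0 ≤ C / Real.log (t + 1) := div_nonneg hC (zero_le_one.trans (hslope t ht).1)
    simp only [Pi.sub_apply]
    linarith
  have h0 : Tendsto (fun t : ℝ => C / Real.log (t + 1)) atTop (𝓝 0) :=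
    tendsto_log_add_one.const_div_atTop C
  exact ⟨l + 0, (hl.add h0).congr fun t => by simp⟩

/-! ### Optimality of the limit -/

/-- In the inverse weights `exp (-θ)` the actor moves by the negative advantage, at a speed that is
common to all the actions in a state. -/
lemma IsLimitSolution.hasDerivWithinAt_exp_neg {M : MDP X A} {α κ : ℝ} {Q θ : ℝ → X → A → ℝ}
    (h : M.IsLimitSolution α κ Q θ) {t : ℝ} (ht : 0 ≤ t) (x : X) (a : A) :
    HasDerivWithinAt (fun s => Real.exp (-θ s x a))
      (learningRate t * (κ * M.stateOccupancy (softmax (θ t)) x / ∑ b, Real.exp (θ t x b)) *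
        -advantage (softmax (θ t)) (Q t) x a) (Set.Ici 0) t := by
  refine (h.hasDerivWithinAt_actor ht x a).neg.exp.congr_deriv ?_
  have hZ := (sum_exp_pos (θ t) x).ne'
  have he := (Real.exp_pos (θ t x a)).ne'
  rw [Pi.neg_apply, Real.exp_neg]
  generalize advantage (softmax (θ t)) (Q t) x a = u
  generalize M.stateOccupancy (softmax (θ t)) x = d
  rw [softmax]
  field_simp

lemma tendsto_bellman {M : MDP X A} {θ : ℝ → X → A → ℝ} {v : X → ℝ}
    (hv : ∀ x, Tendsto (fun t => M.stateValue (softmax (θ t)) x) atTop (𝓝 (v x))) (x : X) (a : A) :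
    Tendsto (fun t => M.actionValue (softmax (θ t)) x a) atTop
      (𝓝 (M.r x a + M.γ * ∑ z, M.p x a z * v z)) := by
  simp only [M.actionValue_bellman (isPolicy_softmax _)]
  exact ((tendsto_finsetSum _ fun z _ => (hv z).const_mul _).const_mul _).const_add _

lemma IsLimitSolution.tendsto_advantage {M : MDP X A}
    (hr : ∀ x a, 0 ≤ M.r x a ∧ M.r x a ≤ 1) (hM : M.IsErgodic) {α κ : ℝ} (hα : 0 < α) (hκ : 0 < κ)
    {Q θ : ℝ → X → A → ℝ} (h : M.IsLimitSolution α κ Q θ) {v : X → ℝ}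
    (hv : ∀ x, Tendsto (fun t => M.stateValue (softmax (θ t)) x) atTop (𝓝 (v x))) (x : X) (a : A) :
    Tendsto (fun t => advantage (softmax (θ t)) (Q t) x a) atTop
      (𝓝 (M.r x a + M.γ * ∑ z, M.p x a z * v z - v x)) := by
  obtain ⟨K, T, hT, hK⟩ := h.exists_abs_critic_sub_le hr hM hα hκ
  have h1 : Tendsto (fun t => advantage (softmax (θ t))
      (Q t - M.actionValue (softmax (θ t))) x a) atTop (𝓝 0) := by
    refine squeeze_zero_norm' (a := fun t => 2 * (K * explorationRate t)) ?_ ?_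
    · filter_upwards [eventually_ge_atTop T] with t ht
      exact (isPolicy_softmax (θ t)).abs_advantage_le (fun b => hK t ht x b) a
    · simpa using (tendsto_explorationRate.const_mul K).const_mul 2
  have h2 := h1.add ((tendsto_bellman hv x a).sub (hv x))
  rw [zero_add] at h2
  refine h2.congr fun t => ?_
  rw [advantage_sub, M.advantage_actionValue (isPolicy_softmax (θ t))]
  ring

/-- No action has a positive advantage in the limit. Otherwise its inverse weight decreases at a
definite fraction of the largest possible speed, so all the inverse weights in that state stay
bounded. As the parameters of a state have a constant sum, they stay bounded, and then that inverse
weight decreases below `0`. -/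
lemma IsLimitSolution.bellman_le_limit {M : MDP X A}
    (hr : ∀ x a, 0 ≤ M.r x a ∧ M.r x a ≤ 1) (hM : M.IsErgodic) {α κ : ℝ} (hα : 0 < α) (hκ : 0 < κ)
    {Q θ : ℝ → X → A → ℝ} (h : M.IsLimitSolution α κ Q θ) (hμ : ∀ x, 0 < M.μ x) {v : X → ℝ}
    (hv : ∀ x, Tendsto (fun t => M.stateValue (softmax (θ t)) x) atTop (𝓝 (v x))) (x : X) (a : A) :
    M.r x a + M.γ * ∑ z, M.p x a z * v z ≤ v x := by
  by_contra! hlt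
  obtain ⟨Δ, hΔ, hΔlt⟩ : ∃ Δ, 0 < Δ ∧ Δ < M.r x a + M.γ * ∑ z, M.p x a z * v z - v x :=
    exists_between (sub_pos.2 hlt)
  obtain ⟨T, hT⟩ := eventually_atTop.1
    (((h.tendsto_advantage hr hM hα hκ hv x a).eventually_const_le hΔlt).and
      (eventually_ge_atTop 0))
  have hT0 : 0 ≤ T := (hT T le_rfl).2
  obtain ⟨C, hC⟩ := h.exists_abs_critic_le hr hM hα
  have hC0 : 0 ≤ C := (abs_nonneg _).trans (hC 0 le_rfl x a)
  have hspeed : ∀ t, T ≤ t → 0 ≤ learningRate t *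
      (κ * M.stateOccupancy (softmax (θ t)) x / ∑ b, Real.exp (θ t x b)) := fun t ht =>
    mul_nonneg (learningRate_pos (hT0.trans ht)).le (div_nonneg
      (mul_nonneg hκ.le (M.stateOccupancy_nonneg (isPolicy_softmax _) x)) (sum_exp_pos _ x).le)
  have hlow : ∀ b, ∃ l, ∀ t, T ≤ t → l ≤ θ t x b := fun b => by
    have hanti := antitoneOn_Ici_of_hasDerivWithinAt hT0
      (fun t ht => (h.hasDerivWithinAt_exp_neg (hT0.trans ht) x b).add
        ((h.hasDerivWithinAt_exp_neg (hT0.trans ht) x a).const_mul (2 * C / Δ)))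
      (fun t ht => by
        have h1 := (isPolicy_softmax (θ t)).abs_advantage_le (hC t (hT0.trans ht) x) b
        have h2 : 2 * C ≤ 2 * C / Δ * advantage (softmax (θ t)) (Q t) x a := by
          rw [div_mul_eq_mul_div, le_div_iff₀ hΔ]
          exact mul_le_mul_of_nonneg_left (hT t ht).1 (by positivity)
        have h3 := mul_nonneg (hspeed t ht) (by linarith [(abs_le.1 h1).1] :
          0 ≤ advantage (softmax (θ t)) (Q t) x b
            + 2 * C / Δ * advantage (softmax (θ t)) (Q t) x a)
        linarith)
    refine ⟨-Real.log (Real.exp (-θ T x b) + 2 * C / Δ * Real.exp (-θ T x a)), fun t ht => ?_⟩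
    have h1 := hanti (Set.mem_Ici.2 le_rfl) (Set.mem_Ici.2 ht) ht
    simp only [Pi.add_apply] at h1
    have h2 : 0 ≤ 2 * C / Δ * Real.exp (-θ t x a) := by positivity
    rw [neg_le, Real.le_log_iff_exp_le (by positivity)]
    linarith
  choose l hl using hlow
  have hsum : AntitoneOn (fun t => ∑ b, θ t x b) (Set.Ici T) :=
    antitoneOn_Ici_of_hasDerivWithinAt hT0
      (fun t ht => HasDerivWithinAt.fun_sum fun b _ =>
        h.hasDerivWithinAt_actor (hT0.trans ht) x b)
      (fun t ht => by
        rw [← Finset.mul_sum, (isPolicy_softmax (θ t)).sum_mul_advantage, mul_zero])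
  set Z := ∑ b, Real.exp (∑ b', (θ T x b' - l b') + l b) with hZ
  have hZpos : 0 < Z := Finset.sum_pos (fun _ _ => Real.exp_pos _) Finset.univ_nonempty
  have hZle : ∀ t, T ≤ t → ∑ b, Real.exp (θ t x b) ≤ Z := fun t ht => by
    refine Finset.sum_le_sum fun b _ => Real.exp_le_exp.2 ?_
    have h1 := hsum (Set.mem_Ici.2 le_rfl) (Set.mem_Ici.2 ht) ht
    have h2 := Finset.single_le_sum (f := fun b => θ t x b - l b)
      (fun b' _ => sub_nonneg.2 (hl b' t ht)) (Finset.mem_univ b)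
    simp only [Finset.sum_sub_distrib] at h1 h2 ⊢
    linarith
  have hdec := antitoneOn_Ici_of_hasDerivWithinAt hT0
    (fun t ht => (h.hasDerivWithinAt_exp_neg (hT0.trans ht) x a).add
      ((hasDerivAt_log_add_one (hT0.trans ht)).hasDerivWithinAt.const_mul (κ * M.μ x / Z * Δ)))
    (fun t ht => by
      have h1 : κ * M.μ x / Z
          ≤ κ * M.stateOccupancy (softmax (θ t)) x / ∑ b, Real.exp (θ t x b) :=
        div_le_div₀ (mul_nonneg hκ.le (M.stateOccupancy_nonneg (isPolicy_softmax _) x))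
          (mul_le_mul_of_nonneg_left (M.le_stateOccupancy (isPolicy_softmax _) x) hκ.le)
          (sum_exp_pos _ x) (hZle t ht)
      have h2 : 0 ≤ κ * M.μ x / Z := div_nonneg (mul_nonneg hκ.le (hμ x).le) hZpos.le
      have h3 := mul_le_mul h1 (hT t ht).1 hΔ.le (h2.trans h1)
      have h4 := mul_le_mul_of_nonneg_left h3 (learningRate_pos (hT0.trans ht)).le
      linarith)
  have hδ : 0 < κ * M.μ x / Z * Δ := mul_pos (div_pos (mul_pos hκ (hμ x)) hZpos) hΔ
  obtain ⟨t, ht, htT⟩ := (((tendsto_log_add_one.const_mul_atTop hδ).eventually_ge_atTop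
    (Real.exp (-θ T x a) + κ * M.μ x / Z * Δ * Real.log (T + 1))).and
      (eventually_ge_atTop T)).exists
  have h1 := hdec (Set.mem_Ici.2 le_rfl) (Set.mem_Ici.2 htT) htT
  simp only [Pi.add_apply] at h1
  linarith [Real.exp_pos (-θ t x a)]

lemma stateValue_le_of_bellman_le (M : MDP X A) {v : X → ℝ}
    (hv : ∀ x a, M.r x a + M.γ * ∑ z, M.p x a z * v z ≤ v x) {f : X → A → ℝ} (hf : IsPolicy f)
    (x : X) : M.stateValue f x ≤ v x := by
  refine sub_nonneg.1 (M.nonneg_of_discounted_le hf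
    (v := fun x => v x - M.stateValue f x) (fun y => ?_) x)
  have h1 : ∑ a, f y a * (M.r y a + M.γ * ∑ z, M.p y a z * v z) ≤ v y := by
    calc _ ≤ ∑ a, f y a * v y :=
          Finset.sum_le_sum fun a _ => mul_le_mul_of_nonneg_left (hv y a) (hf.1 y a)
      _ = v y := by rw [← Finset.sum_mul, hf.2, one_mul]
  have h2 : ∑ a, f y a * (M.r y a + M.γ * ∑ z, M.p y a z * v z)
      = ∑ a, f y a * M.r y a + M.γ * ∑ z, M.stateKernel f y z * v z := by
    rw [M.stateKernel_mulVec, Finset.mul_sum, ← Finset.sum_add_distrib]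
    exact Finset.sum_congr rfl fun a _ => by ring
  have h3 := M.stateValue_bellman hf y
  simp only [mul_sub, Finset.sum_sub_distrib]
  linarith

/-! ### Rate of convergence of the actor -/

/-- Gradient domination near the limit. Let the limit `v` of the state values satisfy the optimality
inequality and let the values at the policy `f` be so close to it that no suboptimal action has
probability at least `1 / |A|`. In a state where the gap to `v` is largest, an action of
probability at least `1 / |A|` is then optimal, and its advantage over `f` is at least `1 - γ` times
the gap. -/
lemma exists_gap_sq_le (M : MDP X A) {v : X → ℝ} {f : X → A → ℝ} (hf : IsPolicy f)
    (hgap : ∀ x a, M.r x a + M.γ * ∑ z, M.p x a z * v z < v x → f x a < 1 / Fintype.card A)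
    (hle : ∀ x, M.stateValue f x ≤ v x) [Nonempty X] :
    ∃ x, ((1 - M.γ) / (Fintype.card A * Fintype.card X)) ^ 2
        * (∑ z, (v z - M.stateValue f z)) ^ 2
      ≤ ∑ a, (f x a * (M.actionValue f x a - M.stateValue f x)) ^ 2 := by
  obtain ⟨x, hx⟩ := Finite.exists_max fun z => v z - M.stateValue f z
  have hA : 0 < (Fintype.card A : ℝ) := Nat.cast_pos.2 Fintype.card_pos
  have hX : 0 < (Fintype.card X : ℝ) := Nat.cast_pos.2 Fintype.card_pos
  have hγ := M.one_sub_discount_pos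
  obtain ⟨a, ha⟩ : ∃ a, 1 / (Fintype.card A : ℝ) ≤ f x a := by
    by_contra! h
    have := Finset.sum_lt_sum_of_nonempty Finset.univ_nonempty fun a (_ : a ∈ Finset.univ) => h a
    rw [hf.2, Finset.sum_const, Finset.card_univ, nsmul_eq_mul, mul_one_div_cancel hA.ne'] at this
    exact lt_irrefl _ this
  have hopt : v x ≤ M.r x a + M.γ * ∑ z, M.p x a z * v z :=
    not_lt.1 fun h => (hgap x a h).not_ge ha
  set D := v x - M.stateValue f x with hD
  have hD0 : 0 ≤ D := sub_nonneg.2 (hle x)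
  have hadv : (1 - M.γ) * D ≤ M.actionValue f x a - M.stateValue f x := by
    have h1 : ∑ z, M.p x a z * (v z - M.stateValue f z) ≤ D := by
      calc _ ≤ ∑ z, M.p x a z * D :=
            Finset.sum_le_sum fun z _ => mul_le_mul_of_nonneg_left (hx z) (M.p_nonneg x a z)
        _ = D := by rw [← Finset.sum_mul, M.p_sum, one_mul]
    have h2 := mul_le_mul_of_nonneg_left h1 M.γ_pos.le
    simp only [mul_sub, Finset.sum_sub_distrib] at h2
    rw [M.actionValue_bellman hf]
    linarith
  have hW : ∑ z, (v z - M.stateValue f z) ≤ Fintype.card X * D := by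
    calc _ ≤ ∑ _z : X, D := Finset.sum_le_sum fun z _ => hx z
      _ = _ := by rw [Finset.sum_const, Finset.card_univ, nsmul_eq_mul]
  have hW0 : 0 ≤ ∑ z, (v z - M.stateValue f z) :=
    Finset.sum_nonneg fun z _ => sub_nonneg.2 (hle z)
  refine ⟨x, le_trans ?_ (Finset.single_le_sum
    (f := fun a => (f x a * (M.actionValue f x a - M.stateValue f x)) ^ 2)
    (fun b _ => sq_nonneg _) (Finset.mem_univ a))⟩
  rw [← mul_pow]
  refine pow_le_pow_left₀ (by positivity) ?_ 2
  calc (1 - M.γ) / (Fintype.card A * Fintype.card X) * ∑ z, (v z - M.stateValue f z)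
      ≤ (1 - M.γ) / (Fintype.card A * Fintype.card X) * (Fintype.card X * D) :=
        mul_le_mul_of_nonneg_left hW (by positivity)
    _ = 1 / Fintype.card A * ((1 - M.γ) * D) := by field_simp
    _ ≤ f x a * (M.actionValue f x a - M.stateValue f x) :=
        mul_le_mul ha hadv (by positivity) (hf.1 x a)

/-- Suboptimal actions are eventually unlikely, because the average of their gaps under the current
policy is at most the gap between the current value and the limit. -/
lemma eventually_softmax_lt {M : MDP X A} {θ : ℝ → X → A → ℝ} {v : X → ℝ}
    (hv : ∀ x, Tendsto (fun t => M.stateValue (softmax (θ t)) x) atTop (𝓝 (v x)))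
    (hbell : ∀ x a, M.r x a + M.γ * ∑ z, M.p x a z * v z ≤ v x) :
    ∀ᶠ t in atTop, ∀ x a, M.r x a + M.γ * ∑ z, M.p x a z * v z < v x →
      softmax (θ t) x a < 1 / Fintype.card A := by
  have hA : 0 < (Fintype.card A : ℝ) := Nat.cast_pos.2 Fintype.card_pos
  rw [eventually_all]; intro x
  rw [eventually_all]; intro a
  by_cases hlt : M.r x a + M.γ * ∑ z, M.p x a z * v z < v x
  swap
  · exact Eventually.of_forall fun t h => absurd h hlt
  have hgap := sub_pos.2 hlt
  have h0 : Tendsto (fun t => v x - M.stateValue (softmax (θ t)) x) atTop (𝓝 0) := by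
    simpa using (hv x).const_sub (v x)
  filter_upwards [h0.eventually_lt_const (mul_pos (one_div_pos.2 hA) hgap)] with t ht _
  have hf := isPolicy_softmax (θ t)
  set q := fun b => M.r x b + M.γ * ∑ z, M.p x b z * v z with hq
  have h1 : M.stateValue (softmax (θ t)) x ≤ ∑ b, softmax (θ t) x b * q b := by
    rw [M.stateValue_eq hf]
    refine Finset.sum_le_sum fun b _ => mul_le_mul_of_nonneg_left ?_ (hf.1 x b)
    rw [M.actionValue_bellman hf]
    exact add_le_add_right (mul_le_mul_of_nonneg_left (Finset.sum_le_sum fun z _ =>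
      mul_le_mul_of_nonneg_left (M.stateValue_le_of_bellman_le hbell hf z) (M.p_nonneg x b z))
      M.γ_pos.le) _
  have h2 : softmax (θ t) x a * (v x - q a) ≤ ∑ b, softmax (θ t) x b * (v x - q b) :=
    Finset.single_le_sum (f := fun b => softmax (θ t) x b * (v x - q b))
      (fun b _ => mul_nonneg (hf.1 x b) (sub_nonneg.2 (hbell x b))) (Finset.mem_univ a)
  simp only [mul_sub, Finset.sum_sub_distrib, ← Finset.sum_mul, hf.2, one_mul] at h2
  refine lt_of_mul_lt_mul_right ?_ hgap.le
  simp only [hq] at h1 h2 ⊢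
  linarith

/-- The total gap `W` satisfies `W' ≤ -c' W ^ 2 + C' / τ ^ 2` in the rescaled time
`τ = log (1 + t)`, and is therefore `O(1 / τ)`. -/
lemma IsLimitSolution.exists_sum_gap_le {M : MDP X A}
    (hr : ∀ x a, 0 ≤ M.r x a ∧ M.r x a ≤ 1) (hM : M.IsErgodic) {α κ : ℝ} (hα : 0 < α) (hκ : 0 < κ)
    {Q θ : ℝ → X → A → ℝ} (h : M.IsLimitSolution α κ Q θ) (hμ : ∀ x, 0 < M.μ x) {v : X → ℝ}
    (hv : ∀ x, Tendsto (fun t => M.stateValue (softmax (θ t)) x) atTop (𝓝 (v x))) :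
    ∃ K T : ℝ, ∀ t, T ≤ t →
      ∑ x, (v x - M.stateValue (softmax (θ t)) x) ≤ K / Real.log (t + 1) := by
  have hX : Nonempty X := by
    by_contra h
    rw [not_nonempty_iff] at h
    simpa using M.μ_sum
  obtain ⟨c, C, T₀, hc, hC, hT₀, hslope⟩ := h.exists_le_valueSlope hr hM hα hκ hμ
  have hbell := h.bellman_le_limit hr hM hα hκ hμ hv
  obtain ⟨T₁, hT₁⟩ := eventually_atTop.1 (eventually_softmax_lt hv hbell)
  set T := max T₀ T₁
  have hT : 0 ≤ T := hT₀.trans (le_max_left _ _)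
  have hγ := M.one_sub_discount_pos
  have hcA : 0 < (Fintype.card A : ℝ) := Nat.cast_pos.2 Fintype.card_pos
  have hcX : 0 < (Fintype.card X : ℝ) := Nat.cast_pos.2 Fintype.card_pos
  set W : ℝ → ℝ := fun t => ∑ x, (v x - M.stateValue (softmax (θ t)) x) with hW
  have hW0 : ∀ t, 0 ≤ W t := fun t => Finset.sum_nonneg fun x _ =>
    sub_nonneg.2 (M.stateValue_le_of_bellman_le hbell (isPolicy_softmax (θ t)) x)
  set S : ℝ → ℝ := fun t => ∑ x, M.valueSlope κ (softmax (θ t)) (Q t) x with hS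
  set c' := c * ((1 - M.γ) / (Fintype.card A * Fintype.card X)) ^ 2 with hc'
  have hc'0 : 0 < c' := by positivity
  set C' := Fintype.card X * C with hC'
  have hC'0 : 0 ≤ C' := by positivity
  have hderiv : ∀ t, T ≤ t → HasDerivWithinAt W (-(learningRate t * S t)) (Set.Ici 0) t :=
    fun t ht => by
      refine (HasDerivWithinAt.fun_sum (u := Finset.univ) fun x _ =>
        (h.hasDerivWithinAt_stateValue (hT.trans ht) x).const_sub (v x)).congr_deriv ?_
      rw [Finset.sum_neg_distrib, hS, Finset.mul_sum]
  have hSlow : ∀ t, T ≤ t → c' * W t ^ 2 - C' / Real.log (t + 1) ^ 2 ≤ S t := fun t ht => by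
    obtain ⟨x, hx⟩ := M.exists_gap_sq_le (isPolicy_softmax (θ t))
      (hT₁ t ((le_max_right _ _).trans ht))
      (M.stateValue_le_of_bellman_le hbell (isPolicy_softmax (θ t)))
    have h1 := Finset.sum_le_sum fun x (_ : x ∈ Finset.univ) =>
      (hslope t ((le_max_left _ _).trans ht)).2 x
    rw [Finset.sum_sub_distrib, ← Finset.mul_sum, Finset.sum_const, Finset.card_univ,
      nsmul_eq_mul] at h1
    have h2 := Finset.single_le_sum (f := fun x => ∑ a, (softmax (θ t) x a *
      (M.actionValue (softmax (θ t)) x a - M.stateValue (softmax (θ t)) x)) ^ 2)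
      (fun x _ => Finset.sum_nonneg fun a _ => sq_nonneg _) (Finset.mem_univ x)
    have h3 := mul_le_mul_of_nonneg_left (hx.trans h2) hc.le
    rw [← mul_assoc] at h3
    rw [hC', mul_div_assoc]
    linarith
  have hL : ∀ t, T ≤ t → 1 ≤ Real.log (t + 1) := fun t ht =>
    (hslope t ((le_max_left _ _).trans ht)).1
  have hLT := zero_lt_one.trans_le (hL T le_rfl)
  -- `K / log (1 + t)` is a strict supersolution as soon as `C' + K < c' * K ^ 2`
  set K := (C' + 1) / c' + 1 + W T * Real.log (T + 1) with hK
  have hK1 : 1 ≤ K := by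
    have h1 : 0 ≤ (C' + 1) / c' := by positivity
    have h2 := mul_nonneg (hW0 T) hLT.le
    linarith
  have hK2 : C' + K < c' * K ^ 2 := by
    have h1 : C' + 1 < c' * K := by
      have h2 : (C' + 1) / c' < K := by
        have := mul_nonneg (hW0 T) hLT.le
        linarith
      rw [div_lt_iff₀ hc'0] at h2
      linarith
    nlinarith
  have hK3 : W T ≤ K / Real.log (T + 1) := by
    rw [le_div_iff₀ hLT]
    have h1 : 0 ≤ (C' + 1) / c' := by positivity
    linarith
  refine ⟨K, T, fun t ht => sub_nonpos.1 (forall_nonpos_of_deriv_neg (ι := Unit) (T := T)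
    (g := fun _ t => W t - K / Real.log (t + 1))
    (g' := fun _ t => -(learningRate t * S t)
      - -(learningRate t * (K / Real.log (t + 1) ^ 2)))
    (fun _ t ht => ?_) (fun _ => sub_nonpos.2 hK3) (fun t ht _ _ h0 => ?_) ht ())⟩
  · exact ((hderiv t ht).sub (hasDerivAt_div_log_add_one K (hT.trans ht)
      (hL t ht)).hasDerivWithinAt).mono (Set.Ici_subset_Ici.2 hT)
  · have hL0 := zero_lt_one.trans_le (hL t ht)
    have h1 := hSlow t ht
    rw [sub_eq_zero.1 h0] at h1
    have h2 : K / Real.log (t + 1) ^ 2 < S t := by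
      refine lt_of_lt_of_le ?_ h1
      rw [div_pow, ← mul_div_assoc, ← sub_div]
      exact div_lt_div_of_pos_right (by linarith) (by positivity)
    have h3 := mul_lt_mul_of_pos_left h2 (learningRate_pos (hT.trans ht))
    linarith

end MDP

end ActorCritic

end

theorem theorem2 {X A : Type*} [Fintype X] [Fintype A] [DecidableEq X] [DecidableEq A] [Nonempty A]
    (M : ActorCritic.MDP X A) (hr : ∀ x a, 0 ≤ M.r x a ∧ M.r x a ≤ 1) (hM : M.IsErgodic)
    (α κ : ℝ) (hα : 0 < α) (hκ : 0 < κ)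
    (Q θ : ℝ → X → A → ℝ) (hQθ : M.IsLimitSolution α κ Q θ) :
    ((fun t : ℝ => ‖Q t - M.actionValue (ActorCritic.softmax (θ t))‖)
        =O[atTop] fun t : ℝ => 1 / Real.log t ^ 2) ∧
    ((∀ x, 0 < M.μ x) → ∀ f : X → A → ℝ, M.IsOptimalPolicy f →
      (fun t : ℝ => M.objective f - M.objective (ActorCritic.softmax (θ t)))
        =O[atTop] fun t : ℝ => 1 / Real.log t) := by
  have hlog : ∀ t : ℝ, 2 ≤ t → 0 < Real.log t ∧ Real.log t ≤ Real.log (t + 1) := fun t ht =>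
    ⟨Real.log_pos (by linarith), Real.log_le_log (by linarith) (by linarith)⟩
  constructor
  · obtain ⟨K, T, hT, hK⟩ := hQθ.exists_abs_critic_sub_le hr hM hα hκ
    refine Asymptotics.IsBigO.of_bound |K| ?_
    filter_upwards [eventually_ge_atTop T, eventually_ge_atTop 2] with t ht ht2
    obtain ⟨hl0, hl⟩ := hlog t ht2
    have hη : ActorCritic.explorationRate t ≤ 1 / Real.log t ^ 2 :=
      one_div_le_one_div_of_le (by positivity)
        (by linarith [pow_le_pow_left₀ hl0.le hl 2])
    have hb : 0 ≤ |K| * (1 / Real.log t ^ 2) := by positivity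
    rw [norm_norm, Real.norm_of_nonneg (by positivity : (0 : ℝ) ≤ 1 / Real.log t ^ 2),
      pi_norm_le_iff_of_nonneg hb]
    refine fun x => (pi_norm_le_iff_of_nonneg hb).2 fun a => (hK t ht x a).trans ?_
    exact mul_le_mul (le_abs_self K) hη (ActorCritic.explorationRate_pos t).le (abs_nonneg K)
  · intro hμ f hf
    obtain ⟨v, hv⟩ := hQθ.exists_tendsto_stateValue hr hM hα hκ hμ
    obtain ⟨K, T, hK⟩ := hQθ.exists_sum_gap_le hr hM hα hκ hμ hv
    have hbell := hQθ.bellman_le_limit hr hM hα hκ hμ hv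
    refine Asymptotics.IsBigO.of_bound |K| ?_
    filter_upwards [eventually_ge_atTop T, eventually_ge_atTop 2] with t ht ht2
    obtain ⟨hl0, hl⟩ := hlog t ht2
    have hpol := ActorCritic.isPolicy_softmax (θ t)
    have hJ : M.objective f - M.objective (ActorCritic.softmax (θ t))
        ≤ ∑ x, (v x - M.stateValue (ActorCritic.softmax (θ t)) x) := by
      rw [ActorCritic.MDP.objective, ActorCritic.MDP.objective, ← Finset.sum_sub_distrib]
      refine Finset.sum_le_sum fun x _ => ?_
      have hμ1 : M.μ x ≤ 1 := by
        rw [← M.μ_sum]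
        exact Finset.single_le_sum (fun y _ => M.μ_nonneg y) (Finset.mem_univ x)
      have h1 := mul_le_mul_of_nonneg_left
        (M.stateValue_le_of_bellman_le hbell hf.1 x) (M.μ_nonneg x)
      have h2 := mul_le_mul_of_nonneg_right hμ1
        (sub_nonneg.2 (M.stateValue_le_of_bellman_le hbell hpol x))
      linarith
    rw [Real.norm_of_nonneg (sub_nonneg.2 (hf.2 _ hpol)),
      Real.norm_of_nonneg (by positivity : (0 : ℝ) ≤ 1 / Real.log t), mul_one_div]
    calc _ ≤ K / Real.log (t + 1) := hJ.trans (hK t ht)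
      _ ≤ |K| / Real.log (t + 1) :=
        div_le_div_of_nonneg_right (le_abs_self K) (hl0.le.trans hl)
      _ ≤ |K| / Real.log t := div_le_div_of_nonneg_left (abs_nonneg K) hl0 hl
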